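/- Let $\{\tau_j\}_{j\in\mathbb Z}$ be a stationary Poisson process on $\mathbb R$ of known intensity $\lambda>0$, let $\{\sigma_j\}_{j\in\mathbb Z}$ be i.i.d. nonnegative service times with distribution function $G$, independent of $\{\tau_j\}$, and let $X(t)=\sum_{j}\mathbf 1(\tau_j\le t,\ \sigma_j>t-\tau_j)$ be the queue length of the steady-state $M/G/\infty$ system. One observes $X_i=X(i\delta)$, $i=1,\dots,n$, where $\delta>0$ and $T=n\delta$. For $\beta>0$ let $\lfloor\beta\rfloor$ be the largest integer strictly less than $\beta$. For a closed interval $I$ and $L,K>0$ let $\mathscr G_\beta(L,I,K)$ be the class of distribution functions $G$ on $[0,\infty)$ that are $\lfloor\beta\rfloor$ times continuously differentiable on $I$, satisfy $|G^{(\lfloor\beta\rfloor)}(x)-G^{(\lfloor\beta\rfloor)}(y)|\le L|x-y|^{\beta-\lfloor\beta\rfloor}$ for all $x,y\in I$, and have second moment at most $K$. Put $\hat\rho_k=\frac1{n-k}\sum_{i=1}^{n-k}X_i$ and $\hat R_k=\frac1{n-k}\sum_{i=1}^{n-k}(X_i-\hat\rho_k)(X_{i+k}-\hat\rho_k)$ for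 $0\le k\le n-1$. For $h>0$ and $x\in[0,T-\delta]$ let $D_x=[0,2h]$ if $x\le h$, $D_x=[x-h,x+h]$ if $h<x\le T-\delta-h$, and $D_x=[T-\delta-2h,T-\delta]$ otherwise; let $M_{D_x}=\{k\in\{1,\dots,n\}:k\delta\in D_x\}$. For an integer $\ell\ge1$ let $\{a_k(x)\}_{k\in M_{D_x}}$ minimize $\sum_k a_k^2$ subject to $\sum_k a_k=0$ and $\sum_k a_k(k\delta)^j=jx^{j-1}$ for $j=1,\dots,\ell$, and set $$\hat G_h(x)=1+\frac1\lambda\sum_{k\in M_{D_x}}a_k(x)\hat R_k .$$ **Theorem.** For every $\ell$ there is a constant $C=C(\ell)$, depending on $\ell$ only, such that the following holds. Let $\beta,L,K,\lambda,d,\delta>0$, $\kappa\in(0,1)$, $T=n\delta$, and let $x_0$ satisfy $I:=[x_0-d,x_0+d]\subset[0,(1-\kappa)T]$. Suppose that $\ell\ge\lfloor\beta\rfloor+1$, that $\delta\le\sqrt K$, and that $$\frac{K(\sqrt K\vee1)}{L^2\kappa}\Big(1+\frac1\lambda\Big)d^{-2\beta-2}\ \le\ T\ \le\ \frac{K(\sqrt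 K\vee1)}{L^2\kappa}\Big(1+\frac1\lambda\Big)\Big[\frac{2}{(\ell+2)\delta}\Big]^{2\beta+2}.$$ Let $h_*=\Big[\frac{K(\sqrt K\vee1)}{L^2\kappa T}\big(1+\frac1\lambda\big)\Big]^{1/(2\beta+2)}$. Then the weights $a_k(x_0)$ with $h=h_*$ exist, and the estimator $\hat G_*(x_0)=\hat G_{h_*}(x_0)$ satisfies $$\sup_{G\in\mathscr G_\beta(L,I,K)}\Big[\mathrm E_G\big|\hat G_*(x_0)-G(x_0)\big|^2\Big]^{1/2}\ \le\ C\,L^{1/(\beta+1)}\Big[\frac{K(\sqrt K\vee1)}{\kappa T}\Big(1+\frac1\lambda\Big)\Big]^{\beta/(2\beta+2)}.$$ -/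

import Mathlib

open MeasureTheory ProbabilityTheory Set
open scoped ENNReal NNReal

universe u

namespace MGInfinity

noncomputable section

/-- The number (with multiplicity) of points of the configuration `p : ℤ → ℝ` lying in `B`. -/
def pointCount (p : ℤ → ℝ) (B : Set ℝ) : ℕ∞ := {j : ℤ | p j ∈ B}.encard

/-- `τ j`, `j ∈ ℤ`, are the points of a stationary Poisson process on the real line with
intensity `lam`: the number of points in a Borel set of finite length `|B|` is Poisson with
parameter `lam * |B|`, and the numbers of points in disjoint sets are independent. -/
structure IsStationaryPoisson {Ω : Type*} [MeasurableSpace Ω] (P : Measure Ω) (lam : ℝ)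
    (τ : ℤ → Ω → ℝ) : Prop where
  measurable : ∀ j, Measurable (τ j)
  law : ∀ B : Set ℝ, MeasurableSet B → volume B ≠ ∞ → ∀ m : ℕ,
    P {ω | pointCount (fun j => τ j ω) B = (m : ℕ∞)}
      = poissonMeasure (Real.toNNReal (lam * (volume B).toReal)) {m}
  indep : ∀ (r : ℕ) (B : Fin r → Set ℝ), (∀ i, MeasurableSet (B i)) →
    (∀ i, volume (B i) ≠ ∞) → Pairwise (fun i i' => Disjoint (B i) (B i')) →
    iIndepFun (fun i ω => pointCount (fun j => τ j ω) (B i)) P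

/-- The data of a steady-state `M/G/∞` queue: arrival epochs `τ j` forming a stationary Poisson
process of rate `lam`, and i.i.d. service times `σ j` with law `ν`, independent of the arrivals. -/
structure IsMGInfinity {Ω : Type*} [MeasurableSpace Ω] (P : Measure Ω) (lam : ℝ)
    (ν : Measure ℝ) (τ σ : ℤ → Ω → ℝ) : Prop where
  arrivals : IsStationaryPoisson P lam τ
  measurable_service : ∀ j, Measurable (σ j)
  law_service : ∀ j, P.map (σ j) = ν
  indep_service : iIndepFun σ P
  indep_arrivals_service : IndepFun (fun ω j => τ j ω) (fun ω j => σ j ω) P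

open Classical in
/-- The queue length `X(t) = ∑_j 1(τ_j ≤ t, σ_j > t - τ_j)`. -/
def queueLength {Ω : Type*} (τ σ : ℤ → Ω → ℝ) (t : ℝ) (ω : Ω) : ℝ :=
  ∑' j : ℤ, if τ j ω ≤ t ∧ t - τ j ω < σ j ω then (1 : ℝ) else 0

/-- The sampled queue length, `X_i = X(iδ)`. -/
def sample {Ω : Type*} (τ σ : ℤ → Ω → ℝ) (δ : ℝ) (ω : Ω) : ℕ → ℝ :=
  fun i => queueLength τ σ (i * δ) ω

/-- The maximal root-mean-square risk of the estimator `est` (a function of the sampled queue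
length) of `G(x₀)`, over all service time laws `ν ∈ 𝒢` with distribution function `G = cdf ν`. The
law of the sampled queue length depends only on `lam`, `ν`, `δ`; the supremum runs over all its
realizations. -/
def maximalRisk (lam δ : ℝ) (est : (ℕ → ℝ) → ℝ) (x₀ : ℝ) (𝒢 : Set (Measure ℝ)) : ℝ≥0∞ :=
  ⨆ (ν : Measure ℝ) (_ : ν ∈ 𝒢) (Ω : Type u) (_ : MeasurableSpace Ω) (P : Measure Ω)
    (_ : IsProbabilityMeasure P) (τ : ℤ → Ω → ℝ) (σ : ℤ → Ω → ℝ)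
    (_ : IsMGInfinity P lam ν τ σ),
    (∫⁻ ω, ‖est (sample τ σ δ ω) - cdf ν x₀‖ₑ ^ 2 ∂P) ^ (1 / 2 : ℝ)

/-- The largest integer strictly less than `β` (for `β > 0`). -/
def strictFloor (β : ℝ) : ℕ := ⌈β⌉₊ - 1

/-- `ν` is a probability law on `[0, ∞)`. -/
def IsServiceLaw (ν : Measure ℝ) : Prop := IsProbabilityMeasure ν ∧ ν (Iio 0) = 0

/-- Laws on `[0, ∞)` whose distribution function is Hölder of order `β` with constant `L` on the
interval `I` (derivatives at end points of `I` are one-sided). -/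
def holderClass (β L : ℝ) (I : Set ℝ) : Set (Measure ℝ) :=
  {ν | IsServiceLaw ν ∧ ContDiffOn ℝ (strictFloor β : ℕ) (cdf ν) I ∧
    ∀ x ∈ I, ∀ y ∈ I,
      |iteratedDerivWithin (strictFloor β) (cdf ν) I x
        - iteratedDerivWithin (strictFloor β) (cdf ν) I y| ≤ L * |x - y| ^ (β - strictFloor β)}

/-- Laws on `[0, ∞)` whose `p`-th moment is at most `K`. -/
def momentClass (p K : ℝ) : Set (Measure ℝ) :=
  {ν | IsServiceLaw ν ∧ ∫⁻ x, ENNReal.ofReal (x ^ p) ∂ν ≤ ENNReal.ofReal K}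

/-- The class `𝒢_β(L, I, K)`. -/
def serviceClass (β L : ℝ) (I : Set ℝ) (K : ℝ) : Set (Measure ℝ) :=
  holderClass β L I ∩ momentClass 2 K

/-- The empirical mean `ρ̂_k = (n-k)⁻¹ ∑_{i=1}^{n-k} X_i`. -/
def rhoHat (n : ℕ) (X : ℕ → ℝ) (k : ℕ) : ℝ :=
  1 / ((n : ℝ) - k) * ∑ i ∈ Finset.Icc 1 (n - k), X i

/-- The empirical covariance
`R̂_k = (n-k)⁻¹ ∑_{i=1}^{n-k} (X_i - ρ̂_k) (X_{i+k} - ρ̂_k)`. -/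
def RHat (n : ℕ) (X : ℕ → ℝ) (k : ℕ) : ℝ :=
  1 / ((n : ℝ) - k) *
    ∑ i ∈ Finset.Icc 1 (n - k), (X i - rhoHat n X k) * (X (i + k) - rhoHat n X k)

/-- The window `D_x ⊆ [0, T-δ]`, `T = nδ`. -/
def window (n : ℕ) (δ h x : ℝ) : Set ℝ :=
  if x ≤ h then Icc 0 (2 * h)
  else if x ≤ n * δ - δ - h then Icc (x - h) (x + h)
  else Icc (n * δ - δ - 2 * h) (n * δ - δ)

open Classical in
/-- The indices `k ∈ {1, …, n}` with `kδ ∈ D_x`. -/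
def windowIdx (n : ℕ) (δ h x : ℝ) : Finset ℕ :=
  (Finset.Icc 1 n).filter (fun k => (k : ℝ) * δ ∈ window n δ h x)

/-- The weights `a` (only its values on the index set of the window matter) satisfy the
constraints: they differentiate all polynomials of degree at most `ℓ` at `x`. -/
def Feasible (n ℓ : ℕ) (δ h x : ℝ) (a : ℕ → ℝ) : Prop :=
  ∑ k ∈ windowIdx n δ h x, a k = 0 ∧
  ∀ j ∈ Finset.Icc 1 ℓ,
    ∑ k ∈ windowIdx n δ h x, a k * ((k : ℝ) * δ) ^ j = (j : ℝ) * x ^ (j - 1)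

/-- `a` solves the problem: minimize `∑ a_k²` subject to the constraints. -/
def IsOptimalWeight (n ℓ : ℕ) (δ h x : ℝ) (a : ℕ → ℝ) : Prop :=
  Feasible n ℓ δ h x a ∧ ∀ b : ℕ → ℝ, Feasible n ℓ δ h x b →
    ∑ k ∈ windowIdx n δ h x, a k ^ 2 ≤ ∑ k ∈ windowIdx n δ h x, b k ^ 2

/-- The estimator `Ĝ_h(x) = 1 + lam⁻¹ ∑_k a_k R̂_k` with weights `a`. -/
def GHat (lam : ℝ) (n : ℕ) (δ h x : ℝ) (a : ℕ → ℝ) (X : ℕ → ℝ) : ℝ :=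
  1 + 1 / lam * ∑ k ∈ windowIdx n δ h x, a k * RHat n X k

/-- The window width `h_*`. -/
def hStar (β L K κ lam T : ℝ) : ℝ :=
  (K * max (√K) 1 / (L ^ 2 * κ * T) * (1 + 1 / lam)) ^ (1 / (2 * β + 2))

end

end MGInfinity

/-! The covariance function of the stationary queue is R(w) = λ ∫ (u - w)⁺ dν(u), so R' = -λ(1 - G)
and G(x₀) = 1 + R'(x₀)/λ. The estimator is a numerical derivative of the empirical covariances,
exact on polynomials of degree at most ℓ.

Weights. Averaging Lagrange differentiation formulas over interleaved sparse grids gives feasible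
weights of size δ/h² on about h/δ nodes. The optimal weights have no larger sum of squares, and
Cauchy–Schwarz gives ∑|a_k| ≤ C/h (`weights_bound`).

Bias. Integrating a Taylor polynomial of G approximates R within λL|y - x₀|^(β+1) by a polynomial of
degree at most ⌊β⌋ + 1 ≤ ℓ whose derivative at x₀ is R'(x₀) (`exists_covFun_approx`). Hence the bias
is at most C · ∑|a_k| · L h^(β+1) (`abs_bias_le`).

Stochastic error. X(t) counts the points of a marked Poisson process in a set, so a linear
combination of queue lengths is a shot noise with moment generating function exp ∫ (e^{θf} - 1) dΛ.
Differentiation gives its central moments, and polarization the joint fourth moments: one fourth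
cumulant plus the three Gaussian pairings. Since ∑_m R(|m|δ) ≤ 2λK/δ, the mean squared error of R̂_k
is at most 20 λ² M², where M² = K(√K ∨ 1)(1 + 1/λ)/(κT), because (n - k)δ ≥ κT on the window
(`integral_RHat_sub_sq_le`). Cauchy–Schwarz with weights |a_k| turns this into an error of order
∑|a_k| · M without using covariances between lags.

The width h_* is the solution of M = L h^(β+1); both errors are then of order L h_*^β, which is the
asserted rate. The two bounds on T say h_* ≤ d and (ℓ + 2)δ ≤ 2h_*. -/

namespace MGInfinity

/-! ### Infinite products with factors at least one -/

/-- The product of a two-sided sequence of extended nonnegative numbers `≥ 1`. -/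
noncomputable def intProd (g : ℤ → ℝ≥0∞) : ℝ≥0∞ :=
  ⨆ n : ℕ, ∏ j ∈ Finset.Icc (-(n : ℤ)) n, g j

lemma monotone_Icc_neg : Monotone fun n : ℕ => Finset.Icc (-(n : ℤ)) n := by
  intro m n h
  apply Finset.Icc_subset_Icc <;> simp [h]

lemma monotone_prod_Icc {g : ℤ → ℝ≥0∞} (hg : ∀ j, 1 ≤ g j) :
    Monotone fun n : ℕ => ∏ j ∈ Finset.Icc (-(n : ℤ)) n, g j := fun _ _ h =>
  Finset.prod_le_prod_of_subset_of_one_le' (monotone_Icc_neg h) fun j _ _ => hg j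

lemma tendsto_intProd {g : ℤ → ℝ≥0∞} (hg : ∀ j, 1 ≤ g j) :
    Filter.Tendsto (fun n : ℕ => ∏ j ∈ Finset.Icc (-(n : ℤ)) n, g j) Filter.atTop
      (nhds (intProd g)) :=
  tendsto_atTop_iSup (monotone_prod_Icc hg)

lemma one_le_intProd {g : ℤ → ℝ≥0∞} (hg : ∀ j, 1 ≤ g j) : 1 ≤ intProd g :=
  (Finset.one_le_prod' fun j _ => hg j).trans (le_iSup (fun n : ℕ =>
    ∏ j ∈ Finset.Icc (-(n : ℤ)) n, g j) 0)

lemma intProd_mul {f g : ℤ → ℝ≥0∞} (hf : ∀ j, 1 ≤ f j) (hg : ∀ j, 1 ≤ g j) :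
    intProd (fun j => f j * g j) = intProd f * intProd g := by
  have h1 := tendsto_intProd (g := fun j => f j * g j) fun j => one_le_mul (hf j) (hg j)
  have h2 := ENNReal.Tendsto.mul (tendsto_intProd hf)
    (Or.inl (zero_lt_one.trans_le (one_le_intProd hf)).ne') (tendsto_intProd hg)
    (Or.inl (zero_lt_one.trans_le (one_le_intProd hg)).ne')
  simp only [Finset.prod_mul_distrib] at h1
  exact tendsto_nhds_unique h1 h2

lemma intProd_one : intProd (fun _ => 1) = 1 := by simp [intProd]

lemma intProd_finset_prod {ι : Type*} (s : Finset ι) {f : ι → ℤ → ℝ≥0∞} (hf : ∀ i j, 1 ≤ f i j) :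
    intProd (fun j => ∏ i ∈ s, f i j) = ∏ i ∈ s, intProd (f i) := by
  classical
  induction s using Finset.induction_on with
  | empty => simp [intProd_one]
  | insert a s ha ih =>
    simp only [Finset.prod_insert ha]
    rw [intProd_mul (hf a) fun j => Finset.one_le_prod' fun i _ => hf i j, ih]

open Classical in
lemma intProd_ite {b : ℤ → Prop} (hb : {j | b j}.Finite) (c : ℝ≥0∞) (hc : 1 ≤ c) :
    intProd (fun j => if b j then c else 1) = c ^ ({j | b j}.encard).toNat := by
  have h1 := tendsto_intProd (g := fun j => if b j then c else 1)
    fun j => by split_ifs <;> simp [hc]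
  refine tendsto_nhds_unique h1 (tendsto_const_nhds.congr' ?_)
  obtain ⟨N, hN⟩ : ∃ N : ℕ, ∀ j ∈ hb.toFinset, j.natAbs ≤ N :=
    ⟨hb.toFinset.sup Int.natAbs, fun j hj => Finset.le_sup hj⟩
  filter_upwards [Filter.eventually_ge_atTop N] with n hn
  rw [← Finset.prod_filter, Finset.prod_const]
  congr 1
  have : (Finset.Icc (-(n : ℤ)) n).filter b = hb.toFinset := by
    ext j
    simp only [Finset.mem_filter, Finset.mem_Icc, Set.Finite.mem_toFinset, mem_ofPred_eq,
      and_iff_right_iff_imp]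
    intro hj
    have := hN j (by simpa using hj)
    omega
  rw [this, hb.encard_eq_coe_toFinset_card]; rfl

/-- Two increasing suprema commute. Factors at least one keep the limits nonzero, so multiplication
in `ℝ≥0∞` is continuous there. This carries product formulas from simple to measurable functions. -/
lemma intProd_iSup {g : ℕ → ℤ → ℝ≥0∞} (hm : ∀ j, Monotone fun k => g k j)
    (hg : ∀ k j, 1 ≤ g k j) :
    intProd (fun j => ⨆ k, g k j) = ⨆ k, intProd (g k) := by
  unfold intProd
  rw [iSup_comm]
  congr 1
  ext n
  have h1 : Filter.Tendsto (fun k => ∏ j ∈ Finset.Icc (-(n : ℤ)) n, g k j) Filter.atTop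
      (nhds (⨆ k, ∏ j ∈ Finset.Icc (-(n : ℤ)) n, g k j)) :=
    tendsto_atTop_iSup fun a b hab => Finset.prod_le_prod' fun j _ => hm j hab
  refine tendsto_nhds_unique ?_ h1
  generalize Finset.Icc (-(n : ℤ)) n = s
  have pos : ∀ k j, g k j ≠ 0 := fun k j => (zero_lt_one.trans_le (hg k j)).ne'
  induction s using Finset.induction_on with
  | empty => simp
  | insert a s ha ih =>
    simp only [Finset.prod_insert ha]
    refine ENNReal.Tendsto.mul (tendsto_atTop_iSup (hm a)) (Or.inl ?_) ih (Or.inl ?_)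
    · exact (zero_lt_one.trans_le ((hg 0 a).trans (le_iSup (fun k => g k a) 0))).ne'
    · refine (zero_lt_one.trans_le (Finset.one_le_prod' fun j _ => ?_)).ne'
      exact (hg 0 j).trans (le_iSup (fun k => g k j) 0)

lemma measurable_intProd {Ω : Type*} [MeasurableSpace Ω] {g : Ω → ℤ → ℝ≥0∞}
    (hg : ∀ j, Measurable fun ω => g ω j) : Measurable fun ω => intProd (g ω) := by
  unfold intProd
  exact Measurable.iSup fun n => Finset.measurable_fun_prod _ fun j _ => hg j

/-! ### The probability generating functional of a Poisson process -/

section Poisson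

variable {Ω : Type*} [MeasurableSpace Ω] {P : Measure Ω}

lemma measurable_pointCount {τ : ℤ → Ω → ℝ} (hτ : ∀ j, Measurable (τ j)) {B : Set ℝ}
    (hB : MeasurableSet B) : Measurable fun ω => pointCount (fun j => τ j ω) B := by
  have h : Measurable fun ω => ((pointCount (fun j => τ j ω) B : ℕ∞) : ℝ≥0∞) := by
    have : (fun ω => ((pointCount (fun j => τ j ω) B : ℕ∞) : ℝ≥0∞))
        = fun ω => ∑' j, (B.indicator 1 (τ j ω) : ℝ≥0∞) := by
      ext ω
      rw [pointCount, ← ENNReal.tsum_set_one,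
        tsum_subtype {j : ℤ | τ j ω ∈ B} (fun _ => (1 : ℝ≥0∞))]
      rfl
    rw [this]
    exact Measurable.tsum fun j => (measurable_one.indicator hB).comp (hτ j)
  refine measurable_to_countable' fun m => ?_
  have : (fun ω => pointCount (fun j => τ j ω) B) ⁻¹' {m}
      = (fun ω => ((pointCount (fun j => τ j ω) B : ℕ∞) : ℝ≥0∞)) ⁻¹' {(m : ℝ≥0∞)} := by
    ext ω; simp
  rw [this]
  exact h (measurableSet_singleton _)

variable [IsProbabilityMeasure P] {N : Ω → ℕ∞} {r : ℝ≥0}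

/-- The Poisson masses of the natural numbers already sum to one, leaving none for `⊤`. -/
lemma ae_ne_top_of_poisson (hN : Measurable N)
    (h : ∀ m : ℕ, P {ω | N ω = m} = poissonMeasure r {m}) : ∀ᵐ ω ∂P, N ω ≠ ⊤ := by
  have hU : P (⋃ m : ℕ, {ω | N ω = m}) = 1 := by
    rw [measure_iUnion]
    · simp_rw [h]
      have := (measure_iUnion (μ := poissonMeasure r) (f := fun m : ℕ => {m})
        (fun i j hij => by simpa using hij) (fun m => measurableSet_singleton m)).symm
      rw [this]
      have hu : (⋃ m : ℕ, ({m} : Set ℕ)) = univ := by ext; simp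
      rw [hu, measure_univ]
    · intro i j hij
      rw [Function.onFun, Set.disjoint_left]
      intro ω h1 h2
      apply hij
      simp only [mem_ofPred_eq] at h1 h2
      exact_mod_cast h1.symm.trans h2
    · exact fun m => hN (measurableSet_singleton _)
  have hae := (prob_compl_eq_zero_iff (μ := P)
    (MeasurableSet.iUnion fun m : ℕ => hN (measurableSet_singleton (m : ℕ∞)))).2 hU
  rw [ae_iff]
  refine measure_mono_null (fun ω hω => ?_) hae
  simp only [ne_eq, not_not, mem_ofPred_eq] at hω
  simp [hω]

lemma map_toNat_of_poisson (hN : Measurable N)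
    (h : ∀ m : ℕ, P {ω | N ω = m} = poissonMeasure r {m}) :
    P.map (fun ω => (N ω).toNat) = poissonMeasure r := by
  have hN' : Measurable fun ω => (N ω).toNat := (Measurable.of_discrete).comp hN
  refine Measure.ext_of_singleton fun m => ?_
  rw [Measure.map_apply hN' (measurableSet_singleton m), ← h m]
  refine measure_congr ?_
  filter_upwards [ae_ne_top_of_poisson hN h] with ω hω
  refine propext ?_
  change (N ω).toNat = m ↔ N ω = m
  lift N ω to ℕ using hω with a
  simp

lemma lintegral_pow_poissonMeasure (r : ℝ≥0) (c : ℝ) (hc : 0 ≤ c) :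
    ∫⁻ m, ENNReal.ofReal c ^ m ∂(poissonMeasure r) = ENNReal.ofReal (Real.exp (r * (c - 1))) := by
  rw [lintegral_countable']
  have h1 : HasSum (fun m : ℕ => Real.exp (-r) * (r * c) ^ m / (m.factorial : ℝ))
      (Real.exp (r * (c - 1))) := by
    have := (NormedSpace.expSeries_div_hasSum_exp ((r : ℝ) * c)).mul_left (Real.exp (-r))
    rw [← Real.exp_eq_exp_ℝ, ← Real.exp_add] at this
    convert! this using 1
    · ext m; rw [mul_div_assoc]
    · ring_nf
  rw [← h1.tsum_eq, ENNReal.ofReal_tsum_of_nonneg (fun m => by positivity) h1.summable]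
  congr 1
  ext m
  rw [poissonMeasure_singleton, ← ENNReal.ofReal_pow hc, ← ENNReal.ofReal_mul (by positivity)]
  congr 1
  rw [mul_pow]; ring

lemma lintegral_pow_of_poisson (hN : Measurable N)
    (h : ∀ m : ℕ, P {ω | N ω = m} = poissonMeasure r {m}) (c : ℝ) (hc : 0 ≤ c) :
    ∫⁻ ω, ENNReal.ofReal c ^ (N ω).toNat ∂P = ENNReal.ofReal (Real.exp (r * (c - 1))) := by
  rw [← lintegral_pow_poissonMeasure r c hc, ← map_toNat_of_poisson hN h,
    lintegral_map Measurable.of_discrete]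
  exact (Measurable.of_discrete (f := ENat.toNat)).comp hN

variable {lam : ℝ} {τ : ℤ → Ω → ℝ}

/-- Grouping points by the value c of φ turns the product into ∏ (1 + c)^N_c, with N_c the number of
points in the fibre of c. The fibres are disjoint, so the N_c are independent Poisson variables and
the generating functions multiply. -/
lemma IsStationaryPoisson.lintegral_intProd_simpleFunc (hτ : IsStationaryPoisson P lam τ)
    (hlam : 0 ≤ lam) (φ : SimpleFunc ℝ ℝ≥0∞) (htop : ∀ x, φ x < ∞)
    (hφ : ∫⁻ x, φ x ≠ ∞) :
    ∫⁻ ω, intProd (fun j => 1 + φ (τ j ω)) ∂P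
      = ENNReal.ofReal (Real.exp (lam * (∫⁻ x, φ x).toReal)) := by
  classical
  -- The value 0 contributes factors 1 and its fibre may have infinite length, so it is discarded.
  set R := φ.range.filter (· ≠ 0) with hR
  have hsum : ∫⁻ x, φ x = ∑ c ∈ R, c * volume (φ ⁻¹' {c}) := by
    rw [φ.lintegral_eq_lintegral, SimpleFunc.lintegral, hR, Finset.sum_filter]
    refine Finset.sum_congr rfl fun c _ => ?_
    by_cases h : c = 0 <;> simp [h]
  have hRtop : ∀ c ∈ R, c ≠ ∞ := by
    intro c hc
    obtain ⟨x, rfl⟩ := SimpleFunc.mem_range.1 (Finset.mem_filter.1 hc).1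
    exact (htop x).ne
  have hvol : ∀ c ∈ R, volume (φ ⁻¹' {c}) ≠ ∞ := by
    intro c hc h
    rw [hsum, ENNReal.sum_ne_top] at hφ
    have := hφ c hc
    rw [h, ENNReal.mul_top (Finset.mem_filter.1 hc).2] at this
    exact this rfl
  have hN : ∀ c, Measurable fun ω => pointCount (fun j => τ j ω) (φ ⁻¹' {c}) := fun c =>
    measurable_pointCount hτ.measurable (φ.measurableSet_fiber c)
  have hlaw : ∀ c ∈ R, ∀ m : ℕ, P {ω | pointCount (fun j => τ j ω) (φ ⁻¹' {c}) = (m : ℕ∞)}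
      = poissonMeasure (Real.toNNReal (lam * (volume (φ ⁻¹' {c})).toReal)) {m} := fun c hc =>
    hτ.law _ (φ.measurableSet_fiber c) (hvol c hc)
  have hae : ∀ᵐ ω ∂P, intProd (fun j => 1 + φ (τ j ω))
      = ∏ c ∈ R, ENNReal.ofReal (1 + c.toReal)
          ^ (pointCount (fun j => τ j ω) (φ ⁻¹' {c})).toNat := by
    -- An infinite count would be read as exponent 0 by `toNat`; almost surely this does not occur.
    have hfin : ∀ᵐ ω ∂P, ∀ c ∈ R, pointCount (fun j => τ j ω) (φ ⁻¹' {c}) ≠ ⊤ :=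
      (Finset.eventually_all R).2 fun c hc => ae_ne_top_of_poisson (hN c) (hlaw c hc)
    filter_upwards [hfin] with ω hω
    have h1 : ∀ x, 1 + φ x = ∏ c ∈ R, if x ∈ φ ⁻¹' {c} then 1 + c else 1 := by
      intro x
      simp only [mem_preimage, mem_singleton_iff]
      rw [Finset.prod_ite_eq]
      split_ifs with h
      · rfl
      · have : φ x = 0 := by
          by_contra h0
          exact h (Finset.mem_filter.2 ⟨φ.mem_range_self x, h0⟩)
        simp [this]
    simp only [h1]
    rw [intProd_finset_prod R fun c j => by split_ifs <;> simp]
    refine Finset.prod_congr rfl fun c hc => ?_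
    rw [intProd_ite (Set.encard_ne_top_iff.1 (hω c hc)) _ (by simp),
      ENNReal.ofReal_add zero_le_one ENNReal.toReal_nonneg, ENNReal.ofReal_one,
      ENNReal.ofReal_toReal (hRtop c hc)]
    rfl
  rw [lintegral_congr_ae hae]
  let e := R.equivFin
  have hind := hτ.indep R.card (fun i => φ ⁻¹' {(e.symm i : ℝ≥0∞)})
    (fun i => φ.measurableSet_fiber _) (fun i => hvol _ (e.symm i).2) (by
      intro i i' hii'
      rw [Set.disjoint_left]
      intro x hx hx'
      simp only [mem_preimage, mem_singleton_iff] at hx hx'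
      exact hii' (e.symm.injective (Subtype.ext (hx.symm.trans hx'))))
  have hind2 := hind.comp
    (fun i (m : ℕ∞) => ENNReal.ofReal (1 + (e.symm i : ℝ≥0∞).toReal) ^ m.toNat)
    fun i => Measurable.of_discrete
  have hprod := lintegral_prod_eq_prod_lintegral_of_indepFun Finset.univ _ hind2
    fun i => (Measurable.of_discrete (f := fun m : ℕ∞ =>
      ENNReal.ofReal (1 + (e.symm i : ℝ≥0∞).toReal) ^ m.toNat)).comp (hN _)
  have hre : ∀ F : ℝ≥0∞ → ℝ≥0∞, ∏ c ∈ R, F c = ∏ i : Fin R.card, F (e.symm i) := by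
    intro F
    rw [← Finset.prod_coe_sort, ← Equiv.prod_comp e.symm]
  simp only [hre]
  simp only [Function.comp_apply] at hprod
  rw [hprod]
  have hi : ∀ i, ∫⁻ ω, ENNReal.ofReal (1 + (e.symm i : ℝ≥0∞).toReal)
      ^ (pointCount (fun j => τ j ω) (φ ⁻¹' {(e.symm i : ℝ≥0∞)})).toNat ∂P
      = ENNReal.ofReal (Real.exp (lam * ((e.symm i : ℝ≥0∞)
        * volume (φ ⁻¹' {(e.symm i : ℝ≥0∞)})).toReal)) := by
    intro i
    rw [lintegral_pow_of_poisson (hN _) (hlaw _ (e.symm i).2) _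
      (by have := ENNReal.toReal_nonneg (a := (e.symm i : ℝ≥0∞)); linarith),
      Real.coe_toNNReal _ (by positivity), ENNReal.toReal_mul]
    congr 2; ring
  rw [Finset.prod_congr rfl fun i _ => hi i,
    ← hre fun c => ENNReal.ofReal (Real.exp (lam * (c * volume (φ ⁻¹' {c})).toReal)),
    ← ENNReal.ofReal_prod_of_nonneg fun _ _ => (Real.exp_pos _).le, ← Real.exp_sum,
    ← Finset.mul_sum, ← ENNReal.toReal_sum, ← hsum]
  exact fun c hc => ENNReal.mul_ne_top (hRtop c hc) (hvol c hc)

/-- The probability generating functional of a stationary Poisson process. -/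
lemma IsStationaryPoisson.lintegral_intProd (hτ : IsStationaryPoisson P lam τ)
    (hlam : 0 ≤ lam) {ψ : ℝ → ℝ≥0∞} (hm : Measurable ψ) (hψ : ∫⁻ x, ψ x ≠ ∞) :
    ∫⁻ ω, intProd (fun j => 1 + ψ (τ j ω)) ∂P
      = ENNReal.ofReal (Real.exp (lam * (∫⁻ x, ψ x).toReal)) := by
  have happ : ∀ x, ψ x = ⨆ k, SimpleFunc.eapprox ψ k x := fun x =>
    (SimpleFunc.iSup_eapprox_apply hm x).symm
  have hmono : ∀ x, Monotone fun k => SimpleFunc.eapprox ψ k x := fun x a b h =>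
    SimpleFunc.monotone_eapprox ψ h x
  have hle : ∀ k, ∫⁻ x, SimpleFunc.eapprox ψ k x ≤ ∫⁻ x, ψ x := fun k =>
    lintegral_mono fun x => by rw [happ x]; exact le_iSup (fun k => SimpleFunc.eapprox ψ k x) k
  have h1 : ∀ ω, intProd (fun j => 1 + ψ (τ j ω))
      = ⨆ k, intProd (fun j => 1 + SimpleFunc.eapprox ψ k (τ j ω)) := by
    intro ω
    rw [← intProd_iSup (g := fun k j => 1 + SimpleFunc.eapprox ψ k (τ j ω))
      (fun j a b h => add_le_add le_rfl (hmono _ h)) fun k j => by simp]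
    simp only [happ, ENNReal.add_iSup]
  have hmonoI : ∀ ω, Monotone fun k => intProd (fun j => 1 + SimpleFunc.eapprox ψ k (τ j ω)) := by
    intro ω a b h
    refine iSup_mono fun n => Finset.prod_le_prod' fun j _ => ?_
    gcongr
    exact hmono _ h
  simp only [h1]
  rw [lintegral_iSup (fun k => measurable_intProd fun j => ?_) fun a b h ω => hmonoI ω h]
  · have h2 : Filter.Tendsto (fun k => ∫⁻ x, SimpleFunc.eapprox ψ k x) Filter.atTop
        (nhds (∫⁻ x, ψ x)) := by
      simp only [happ]
      rw [lintegral_iSup (fun k => SimpleFunc.measurable _) fun a b h x => hmono x h]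
      exact tendsto_atTop_iSup fun a b h => lintegral_mono fun x => hmono x h
    have h3 : Filter.Tendsto
        (fun k => ENNReal.ofReal (Real.exp (lam * (∫⁻ x, SimpleFunc.eapprox ψ k x).toReal)))
        Filter.atTop (nhds (ENNReal.ofReal (Real.exp (lam * (∫⁻ x, ψ x).toReal)))) :=
      ENNReal.tendsto_ofReal ((Real.continuous_exp.tendsto _).comp
        (((ENNReal.tendsto_toReal hψ).comp h2).const_mul lam))
    refine tendsto_nhds_unique (tendsto_atTop_iSup fun a b h =>
      lintegral_mono fun ω => hmonoI ω h) (h3.congr fun k => ?_)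
    rw [hτ.lintegral_intProd_simpleFunc hlam _ (fun x => SimpleFunc.eapprox_lt_top ψ k x)
      (ne_top_of_le_ne_top hψ (hle k))]
  · exact ((SimpleFunc.measurable _).comp (hτ.measurable j)).const_add 1

end Poisson

/-! ### Attaching the service times as independent marks -/

section Marks

variable {Ω : Type*} [MeasurableSpace Ω] {P : Measure Ω} {lam : ℝ} {ν : Measure ℝ}
  {τ σ : ℤ → Ω → ℝ}

lemma IsMGInfinity.isProbabilityMeasure [IsProbabilityMeasure P]
    (hq : IsMGInfinity P lam ν τ σ) : IsProbabilityMeasure ν := by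
  rw [← hq.law_service 0]
  exact Measure.isProbabilityMeasure_map (hq.measurable_service 0).aemeasurable

/-- Given the arrivals, the service times are still i.i.d. with law ν, so each mark integrates out
separately (Fubini on the product of the two sequence laws). -/
lemma IsMGInfinity.lintegral_prod [IsProbabilityMeasure P] (hq : IsMGInfinity P lam ν τ σ)
    (J : Finset ℤ) {G : ℝ × ℝ → ℝ≥0∞} (hG : Measurable G) :
    ∫⁻ ω, ∏ j ∈ J, G (τ j ω, σ j ω) ∂P = ∫⁻ ω, ∏ j ∈ J, ∫⁻ u, G (τ j ω, u) ∂ν ∂P := by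
  have hT : Measurable fun ω j => τ j ω := measurable_pi_lambda _ hq.arrivals.measurable
  have hS : Measurable fun ω j => σ j ω := measurable_pi_lambda _ hq.measurable_service
  have hF : Measurable fun p : (ℤ → ℝ) × (ℤ → ℝ) => ∏ j ∈ J, G (p.1 j, p.2 j) :=
    Finset.measurable_fun_prod _ fun j _ => hG.comp (by fun_prop)
  have h1 : ∫⁻ ω, ∏ j ∈ J, G (τ j ω, σ j ω) ∂P
      = ∫⁻ p, ∏ j ∈ J, G (p.1 j, p.2 j) ∂(P.map fun ω => (fun j => τ j ω, fun j => σ j ω)) := by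
    rw [lintegral_map hF (hT.prodMk hS)]
  have hinner : ∀ t : ℤ → ℝ, ∫⁻ s, ∏ j ∈ J, G (t j, s j) ∂(P.map fun ω j => σ j ω)
      = ∏ j ∈ J, ∫⁻ u, G (t j, u) ∂ν := by
    intro t
    have hm : Measurable fun s : ℤ → ℝ => ∏ j ∈ J, G (t j, s j) :=
      Finset.measurable_fun_prod _ fun j _ =>
        hG.comp (measurable_const.prodMk (measurable_pi_apply j))
    rw [lintegral_map hm hS]
    have hi := hq.indep_service.comp (fun j u => G (t j, u)) fun j => hG.comp (by fun_prop)
    have := lintegral_prod_eq_prod_lintegral_of_indepFun J _ hi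
      fun j => (hG.comp (f := fun u => (t j, u)) (by fun_prop)).comp (hq.measurable_service j)
    simp only [Function.comp_apply] at this
    rw [this]
    refine Finset.prod_congr rfl fun j _ => ?_
    have hGj : Measurable fun u => G (t j, u) := hG.comp (by fun_prop)
    rw [← hq.law_service j, lintegral_map hGj (hq.measurable_service j)]
  have := hq.isProbabilityMeasure
  rw [h1, hq.indep_arrivals_service.map_prod_eq_prod_map_map hT.aemeasurable hS.aemeasurable,
    MeasureTheory.lintegral_prod _ hF.aemeasurable]
  simp only [hinner]
  rw [lintegral_map _ hT]
  exact Finset.measurable_fun_prod _ fun j _ =>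
    (Measurable.lintegral_prod_right' hG).comp (measurable_pi_apply j)

/-- Integrating out the marks replaces φ by its mark average x ↦ ∫ φ(x, u) dν(u), to which the
functional of the unmarked process applies. -/
lemma IsMGInfinity.lintegral_intProd [IsProbabilityMeasure P] (hq : IsMGInfinity P lam ν τ σ)
    (hlam : 0 ≤ lam) {φ : ℝ × ℝ → ℝ≥0∞} (hφ : Measurable φ)
    (hfin : ∫⁻ p, φ p ∂(volume.prod ν) ≠ ∞) :
    ∫⁻ ω, intProd (fun j => 1 + φ (τ j ω, σ j ω)) ∂P
      = ENNReal.ofReal (Real.exp (lam * (∫⁻ p, φ p ∂(volume.prod ν)).toReal)) := by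
  have := hq.isProbabilityMeasure
  rw [MeasureTheory.lintegral_prod _ hφ.aemeasurable] at hfin ⊢
  have hψ : Measurable fun x => ∫⁻ u, φ (x, u) ∂ν := Measurable.lintegral_prod_right' hφ
  rw [← hq.arrivals.lintegral_intProd hlam hψ hfin]
  have hG : Measurable fun p => 1 + φ p := hφ.const_add 1
  have hone : ∀ x, 1 + ∫⁻ u, φ (x, u) ∂ν = ∫⁻ u, (1 + φ (x, u)) ∂ν := by
    intro x
    rw [lintegral_add_left measurable_const]
    simp
  simp only [hone, intProd]
  have hmG : ∀ j, Measurable fun ω => 1 + φ (τ j ω, σ j ω) := fun j =>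
    hG.comp ((hq.arrivals.measurable j).prodMk (hq.measurable_service j))
  have hmg : ∀ j, Measurable fun ω => ∫⁻ u, (1 + φ (τ j ω, u)) ∂ν := fun j =>
    (Measurable.lintegral_prod_right' hG).comp (hq.arrivals.measurable j)
  rw [lintegral_iSup (fun n => Finset.measurable_fun_prod _ fun j _ => hmG j),
    lintegral_iSup (fun n => Finset.measurable_fun_prod _ fun j _ => hmg j)]
  · congr 1
    ext n
    exact hq.lintegral_prod _ hG
  · intro a b h ω
    refine monotone_prod_Icc (g := fun j => ∫⁻ u, (1 + φ (τ j ω, u)) ∂ν) (fun j => ?_) h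
    simp only [← hone]
    simp
  · intro a b h ω
    exact monotone_prod_Icc (g := fun j => 1 + φ (τ j ω, σ j ω)) (fun j => by simp) h

end Marks

/-! ### Exponential and central moments of shot noise -/

lemma intProd_exp {a : ℤ → ℝ} (ha : ∀ j, 0 ≤ a j) (hs : Summable a) :
    intProd (fun j => ENNReal.ofReal (Real.exp (a j))) = ENNReal.ofReal (Real.exp (∑' j, a j)) := by
  refine tendsto_nhds_unique (tendsto_intProd fun j => ?_) ?_
  · rw [ENNReal.one_le_ofReal]; exact Real.one_le_exp (ha j)
  · have h1 : Filter.Tendsto (fun n : ℕ => Finset.Icc (-(n : ℤ)) n) Filter.atTop Filter.atTop :=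
      Filter.tendsto_atTop_finset_of_monotone monotone_Icc_neg fun j =>
        ⟨j.natAbs, by rw [Finset.mem_Icc]; omega⟩
    have h2 := ENNReal.tendsto_ofReal
      ((Real.continuous_exp.tendsto _).comp (hs.hasSum.comp h1))
    refine h2.congr fun n => ?_
    simp only [Function.comp_apply]
    rw [Real.exp_sum, ENNReal.ofReal_prod_of_nonneg fun _ _ => (Real.exp_pos _).le]

/-- Every finite partial sum s satisfies s + 1 ≤ exp s ≤ C, where C is the finite product. -/
lemma summable_of_intProd_exp {a : ℤ → ℝ} (ha : ∀ j, 0 ≤ a j)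
    (h : intProd (fun j => ENNReal.ofReal (Real.exp (a j))) ≠ ∞) : Summable a := by
  set C := intProd (fun j => ENNReal.ofReal (Real.exp (a j)))
  refine summable_of_sum_le ha (c := C.toReal) fun s => ?_
  have hsub : s ⊆ Finset.Icc (-((s.sup Int.natAbs : ℕ) : ℤ)) (s.sup Int.natAbs : ℕ) := by
    intro j hj
    have := Finset.le_sup (f := Int.natAbs) hj
    rw [Finset.mem_Icc]
    omega
  have h1 : ENNReal.ofReal (Real.exp (∑ j ∈ s, a j)) ≤ C := by
    refine le_trans ?_ (le_iSup (fun n : ℕ => ∏ j ∈ Finset.Icc (-(n : ℤ)) n,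
      ENNReal.ofReal (Real.exp (a j))) (s.sup Int.natAbs))
    rw [Real.exp_sum, ENNReal.ofReal_prod_of_nonneg fun _ _ => (Real.exp_pos _).le]
    exact Finset.prod_le_prod_of_subset_of_one_le' hsub fun j _ _ => by
      rw [ENNReal.one_le_ofReal]; exact Real.one_le_exp (ha j)
  have h2 := (ENNReal.ofReal_le_iff_le_toReal h).1 h1
  have := Real.add_one_le_exp (∑ j ∈ s, a j)
  linarith

/-- The intensity measure of the marked arrival process. -/
noncomputable def intensity (lam : ℝ) (ν : Measure ℝ) : Measure (ℝ × ℝ) :=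
  ENNReal.ofReal lam • volume.prod ν

section ShotNoise

variable {Ω : Type*} [MeasurableSpace Ω] {P : Measure Ω} [IsProbabilityMeasure P] {lam : ℝ}
  {ν : Measure ℝ} {τ σ : ℤ → Ω → ℝ} {f : ℝ × ℝ → ℝ} {A : Set (ℝ × ℝ)} {b : ℝ}

lemma integrable_of_bounded_of_support {Λ : Measure (ℝ × ℝ)} (hA : MeasurableSet A)
    (hΛ : Λ A ≠ ∞) {g : ℝ × ℝ → ℝ} (hg : Measurable g) (hb : ∀ p, |g p| ≤ b)
    (hgA : ∀ p, p ∉ A → g p = 0) : Integrable g Λ := by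
  have : IntegrableOn g A Λ :=
    Measure.integrableOn_of_bounded hΛ hg.aestronglyMeasurable (M := b)
      (Filter.Eventually.of_forall hb)
  rw [← integrable_indicator_iff hA] at this
  have heq : A.indicator g = g := by
    ext p
    by_cases hp : p ∈ A <;> simp [hp, hgA p]
  rwa [heq] at this

/-- This is the generating functional at φ = e^{θf} - 1. The restriction θ ≥ 0 makes φ nonnegative,
so that the products are monotone. -/
lemma IsMGInfinity.lintegral_intProd_exp (hq : IsMGInfinity P lam ν τ σ) (hlam : 0 < lam)
    (hf : Measurable f) (hf0 : ∀ p, 0 ≤ f p) (hfb : ∀ p, f p ≤ b) (hA : MeasurableSet A)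
    (hΛ : intensity lam ν A ≠ ∞) (hfA : ∀ p, p ∉ A → f p = 0) {θ : ℝ} (hθ : 0 ≤ θ) :
    ∫⁻ ω, intProd (fun j => ENNReal.ofReal (Real.exp (θ * f (τ j ω, σ j ω)))) ∂P
      = ENNReal.ofReal (Real.exp (∫ p, (Real.exp (θ * f p) - 1) ∂(intensity lam ν))) := by
  have hb : 0 ≤ b := (hf0 (0, 0)).trans (hfb (0, 0))
  have hexp : ∀ p, 1 ≤ Real.exp (θ * f p) := fun p => Real.one_le_exp (mul_nonneg hθ (hf0 p))
  set φ : ℝ × ℝ → ℝ≥0∞ := fun p => ENNReal.ofReal (Real.exp (θ * f p) - 1) with hφ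
  have hφm : Measurable φ := by fun_prop
  have h1 : ∀ p, ENNReal.ofReal (Real.exp (θ * f p)) = 1 + φ p := by
    intro p
    rw [hφ, ← ENNReal.ofReal_one, ← ENNReal.ofReal_add zero_le_one (by linarith [hexp p])]
    congr 1; ring
  have hint : Integrable (fun p => Real.exp (θ * f p) - 1) (intensity lam ν) := by
    refine integrable_of_bounded_of_support (b := Real.exp (θ * b)) hA hΛ (by fun_prop)
      (fun p => ?_) fun p hp => by simp [hfA p hp]
    rw [abs_of_nonneg (by linarith [hexp p])]
    have : Real.exp (θ * f p) ≤ Real.exp (θ * b) :=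
      Real.exp_le_exp.2 (mul_le_mul_of_nonneg_left (hfb p) hθ)
    linarith
  have hlam' : ENNReal.ofReal lam ≠ 0 := by simpa using hlam
  have hfin : ∫⁻ p, φ p ∂(volume.prod ν) ≠ ∞ := by
    have h2 := hint.lintegral_lt_top
    rw [intensity, lintegral_smul_measure] at h2
    intro h
    rw [hφ] at h
    rw [h, smul_eq_mul, ENNReal.mul_top hlam'] at h2
    exact lt_irrefl _ h2
  simp only [h1]
  rw [hq.lintegral_intProd hlam.le hφm hfin,
    integral_eq_lintegral_of_nonneg_ae (Filter.Eventually.of_forall fun p => by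
      simpa using hexp p) hint.1, intensity, lintegral_smul_measure, smul_eq_mul,
    ENNReal.toReal_mul, ENNReal.toReal_ofReal hlam.le]

/-- The exponential product at θ = 1 has finite mean, hence is finite almost surely. Without
summability the real series would take the default value 0. -/
lemma IsMGInfinity.ae_summable (hq : IsMGInfinity P lam ν τ σ) (hlam : 0 < lam)
    (hf : Measurable f) (hf0 : ∀ p, 0 ≤ f p) (hfb : ∀ p, f p ≤ b) (hA : MeasurableSet A)
    (hΛ : intensity lam ν A ≠ ∞) (hfA : ∀ p, p ∉ A → f p = 0) :
    ∀ᵐ ω ∂P, Summable fun j => f (τ j ω, σ j ω) := by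
  have h1 := hq.lintegral_intProd_exp hlam hf hf0 hfb hA hΛ hfA zero_le_one
  have hm : Measurable fun ω =>
      intProd (fun j => ENNReal.ofReal (Real.exp (1 * f (τ j ω, σ j ω)))) :=
    measurable_intProd fun j => by
      have := (hf.comp ((hq.arrivals.measurable j).prodMk (hq.measurable_service j)))
      exact (this.const_mul 1).exp.ennreal_ofReal
  filter_upwards [ae_lt_top hm (by rw [h1]; exact ENNReal.ofReal_ne_top)] with ω hω
  refine summable_of_intProd_exp (fun j => hf0 _) ?_
  simpa using hω.ne

lemma measurable_real_tsum {g : ℤ → Ω → ℝ} (hg : ∀ j, Measurable (g j)) (h0 : ∀ j ω, 0 ≤ g j ω) :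
    Measurable fun ω => ∑' j, g j ω := by
  have : (fun ω => ∑' j, g j ω) = fun ω => (∑' j, ENNReal.ofReal (g j ω)).toReal := by
    ext ω
    rw [ENNReal.tsum_toReal_eq fun j => ENNReal.ofReal_ne_top]
    simp [h0]
  rw [this]
  exact (Measurable.tsum fun j => (hg j).ennreal_ofReal).ennreal_toReal

lemma IsMGInfinity.mgf_tsum (hq : IsMGInfinity P lam ν τ σ) (hlam : 0 < lam)
    (hf : Measurable f) (hf0 : ∀ p, 0 ≤ f p) (hfb : ∀ p, f p ≤ b) (hA : MeasurableSet A)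
    (hΛ : intensity lam ν A ≠ ∞) (hfA : ∀ p, p ∉ A → f p = 0) {θ : ℝ} (hθ : 0 ≤ θ) :
    Integrable (fun ω => Real.exp (θ * ∑' j, f (τ j ω, σ j ω))) P ∧
    mgf (fun ω => ∑' j, f (τ j ω, σ j ω)) P θ
      = Real.exp (∫ p, (Real.exp (θ * f p) - 1) ∂(intensity lam ν)) := by
  have h1 := hq.lintegral_intProd_exp hlam hf hf0 hfb hA hΛ hfA hθ
  have h2 : ∫⁻ ω, ENNReal.ofReal (Real.exp (θ * ∑' j, f (τ j ω, σ j ω))) ∂P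
      = ENNReal.ofReal (Real.exp (∫ p, (Real.exp (θ * f p) - 1) ∂(intensity lam ν))) := by
    rw [← h1]
    refine lintegral_congr_ae ?_
    filter_upwards [hq.ae_summable hlam hf hf0 hfb hA hΛ hfA] with ω hω
    rw [intProd_exp (fun j => mul_nonneg hθ (hf0 _)) (hω.mul_left θ), tsum_mul_left]
  have hm : Measurable fun ω => ∑' j, f (τ j ω, σ j ω) := measurable_real_tsum
    (fun j => hf.comp ((hq.arrivals.measurable j).prodMk (hq.measurable_service j)))
    fun j ω => hf0 _
  have hm2 : Measurable fun ω => Real.exp (θ * ∑' j, f (τ j ω, σ j ω)) := by fun_prop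
  have h0 : 0 ≤ᵐ[P] fun ω => Real.exp (θ * ∑' j, f (τ j ω, σ j ω)) :=
    Filter.Eventually.of_forall fun ω => (Real.exp_pos _).le
  refine ⟨⟨hm2.aestronglyMeasurable, ?_⟩, ?_⟩
  · rw [hasFiniteIntegral_iff_ofReal h0, h2]
    exact ENNReal.ofReal_lt_top
  · rw [mgf, integral_eq_lintegral_of_nonneg_ae h0 hm2.aestronglyMeasurable, h2,
      ENNReal.toReal_ofReal (Real.exp_pos _).le]

/-- For θ ≤ 0 the exponential of a nonnegative sum is at most 1. Having exponential moments on both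
sides of 0 makes the moment generating function analytic there. -/
lemma IsMGInfinity.integrableExpSet_tsum (hq : IsMGInfinity P lam ν τ σ) (hlam : 0 < lam)
    (hf : Measurable f) (hf0 : ∀ p, 0 ≤ f p) (hfb : ∀ p, f p ≤ b) (hA : MeasurableSet A)
    (hΛ : intensity lam ν A ≠ ∞) (hfA : ∀ p, p ∉ A → f p = 0) :
    integrableExpSet (fun ω => ∑' j, f (τ j ω, σ j ω)) P = univ := by
  refine eq_univ_of_forall fun θ => ?_
  rcases le_total 0 θ with hθ | hθ
  · exact (hq.mgf_tsum hlam hf hf0 hfb hA hΛ hfA hθ).1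
  · have hm : Measurable fun ω => ∑' j, f (τ j ω, σ j ω) := measurable_real_tsum
      (fun j => hf.comp ((hq.arrivals.measurable j).prodMk (hq.measurable_service j)))
      fun j ω => hf0 _
    refine Integrable.of_bound (C := 1) (hm.const_mul θ).exp.aestronglyMeasurable
      (Filter.Eventually.of_forall fun ω => ?_)
    rw [Real.norm_of_nonneg (Real.exp_pos _).le, Real.exp_le_one_iff]
    exact mul_nonpos_of_nonpos_of_nonneg hθ (tsum_nonneg fun j => hf0 _)

/-- Second and fourth central moments of a shot noise functional. -/
lemma IsMGInfinity.central_moments (hq : IsMGInfinity P lam ν τ σ) (hlam : 0 < lam)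
    (hf : Measurable f) (hf0 : ∀ p, 0 ≤ f p) (hfb : ∀ p, f p ≤ b) (hA : MeasurableSet A)
    (hΛ : intensity lam ν A ≠ ∞) (hfA : ∀ p, p ∉ A → f p = 0) {W : Ω → ℝ}
    (hW : W = fun ω => ∑' j, f (τ j ω, σ j ω) - ∫ p, f p ∂(intensity lam ν)) :
    (∀ n : ℕ, Integrable (fun ω => W ω ^ n) P) ∧
    ∫ ω, W ω ^ 2 ∂P = ∫ p, f p ^ 2 ∂(intensity lam ν) ∧
    ∫ ω, W ω ^ 4 ∂P
      = ∫ p, f p ^ 4 ∂(intensity lam ν) + 3 * (∫ p, f p ^ 2 ∂(intensity lam ν)) ^ 2 := by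
  set Λ := intensity lam ν with hΛdef
  set S : Ω → ℝ := fun ω => ∑' j, f (τ j ω, σ j ω) with hS
  set m := ∫ p, f p ∂Λ with hm
  have hSuniv := hq.integrableExpSet_tsum hlam hf hf0 hfb hA hΛ hfA
  -- Λ may be infinite, and e^{θf} equals 1 off A; restricting to A makes it integrable without
  -- changing the moments of f of positive order.
  have hfin : IsFiniteMeasure (Λ.restrict A) := ⟨by simpa using hΛ.lt_top⟩
  have hfuniv : integrableExpSet f (Λ.restrict A) = univ := by
    refine eq_univ_of_forall fun θ => ?_
    refine Integrable.of_bound (C := Real.exp (|θ| * b)) (by fun_prop)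
      (Filter.Eventually.of_forall fun p => ?_)
    rw [Real.norm_of_nonneg (Real.exp_pos _).le, Real.exp_le_exp]
    calc θ * f p ≤ |θ| * f p := mul_le_mul_of_nonneg_right (le_abs_self _) (hf0 p)
      _ ≤ |θ| * b := mul_le_mul_of_nonneg_left (hfb p) (abs_nonneg _)
  have hWuniv : integrableExpSet W P = univ := by
    refine eq_univ_of_forall fun θ => ?_
    have h1 : Integrable (fun ω => Real.exp (θ * S ω)) P := by
      have : θ ∈ integrableExpSet S P := hSuniv ▸ mem_univ θ
      exact this
    have h2 := h1.mul_const (Real.exp (-(θ * m)))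
    refine h2.congr (Filter.Eventually.of_forall fun ω => ?_)
    simp only [hW]
    rw [← Real.exp_add]; congr 1; ring
  -- the moments of `f` as derivatives
  set k : ℕ → ℝ → ℝ := fun n θ => ∫ p, f p ^ n * Real.exp (θ * f p) ∂(Λ.restrict A) with hk
  have hkd : ∀ n θ, HasDerivAt (k n) (k (n + 1) θ) θ := fun n θ =>
    hasDerivAt_integral_pow_mul_exp_real (by rw [hfuniv]; simp) n
  have hk0 : ∀ n, n ≠ 0 → k n 0 = ∫ p, f p ^ n ∂Λ := by
    intro n hn
    simp only [hk, zero_mul, Real.exp_zero, mul_one]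
    refine setIntegral_eq_integral_of_forall_compl_eq_zero fun p hp => ?_
    rw [hfA p hp, zero_pow hn]
  have hcum : ∀ θ, ∫ p, (Real.exp (θ * f p) - 1) ∂Λ = k 0 θ - (Λ A).toReal := by
    intro θ
    have hi : Integrable (fun p => Real.exp (θ * f p)) (Λ.restrict A) := by
      have : θ ∈ integrableExpSet f (Λ.restrict A) := hfuniv ▸ mem_univ θ
      exact this
    rw [← setIntegral_eq_integral_of_forall_compl_eq_zero (s := A)
      (fun p hp => by simp [hfA p hp]), integral_sub hi (integrable_const _)]
    simp [hk, Measure.real]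
  set g : ℝ → ℝ := fun θ => k 0 θ - (Λ A).toReal - θ * m with hg
  -- The formula is known for θ ≥ 0 only, while derivatives at 0 need both sides. Both sides of the
  -- identity are analytic and agree on (0, ∞), which accumulates at 0, so they agree everywhere.
  have hmgf : mgf W P = fun θ => Real.exp (g θ) := by
    have ha1 : AnalyticOnNhd ℝ (mgf W P) univ := by
      have := analyticOnNhd_mgf (X := W) (μ := P)
      rwa [hWuniv, interior_univ] at this
    have ha0 : AnalyticOnNhd ℝ (k 0) univ := by
      have := analyticOnNhd_mgf (X := f) (μ := Λ.restrict A)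
      rw [hfuniv, interior_univ] at this
      convert this using 1
      ext θ
      simp [hk, mgf]
    have ha2 : AnalyticOnNhd ℝ (fun θ => Real.exp (g θ)) univ := by
      refine AnalyticOnNhd.rexp ?_
      exact (ha0.sub analyticOnNhd_const).sub (analyticOnNhd_id.mul analyticOnNhd_const)
    refine ha1.eq_of_frequently_eq ha2 (z₀ := 0) ?_
    have hev : ∀ᶠ θ in nhdsWithin (0 : ℝ) (Ioi 0), mgf W P θ = Real.exp (g θ) := by
      filter_upwards [self_mem_nhdsWithin] with θ hθ
      have h1 := (hq.mgf_tsum hlam hf hf0 hfb hA hΛ hfA (le_of_lt hθ)).2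
      rw [hcum] at h1
      have h2 : mgf W P θ = Real.exp (-(θ * m)) * mgf S P θ := by
        rw [mgf, mgf, ← integral_const_mul]
        refine integral_congr_ae (Filter.Eventually.of_forall fun ω => ?_)
        simp only [hW]
        rw [← Real.exp_add]; congr 1; ring
      rw [h2, h1, ← Real.exp_add]
      congr 1
      simp only [hg]; ring
    exact (hev.frequently).filter_mono (nhdsWithin_mono _ fun x hx => ne_of_gt hx)
  have hk00 : k 0 0 = (Λ A).toReal := by simp [hk, Measure.real]
  have hg0 : g 0 = 0 := by simp [hg, hk00]
  have hgd : ∀ θ, HasDerivAt g (k 1 θ - m) θ := fun θ => by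
    have := ((hkd 0 θ).sub_const (Λ A).toReal).sub ((hasDerivAt_id θ).mul_const m)
    rwa [one_mul] at this
  have hk10 : k 1 0 = m := by rw [hk0 1 one_ne_zero]; simp [hm]
  have hE : ∀ θ, HasDerivAt (fun θ => Real.exp (g θ)) (Real.exp (g θ) * (k 1 θ - m)) θ :=
    fun θ => (hgd θ).exp
  have hk1 : ∀ θ, HasDerivAt (fun θ => k 1 θ - m) (k 2 θ) θ := fun θ => (hkd 1 θ).sub_const m
  -- Four successive derivatives of exp ∘ g. At 0 the factor k 1 - m vanishes, which leaves k 2 for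
  -- the second moment and k 4 + 3 (k 2)² for the fourth.
  have d1 : deriv (fun θ => Real.exp (g θ)) = fun θ => Real.exp (g θ) * (k 1 θ - m) :=
    funext fun θ => (hE θ).deriv
  have d2 : deriv (fun θ => Real.exp (g θ) * (k 1 θ - m))
      = fun θ => Real.exp (g θ) * ((k 1 θ - m) ^ 2 + k 2 θ) := funext fun θ => by
    rw [((hE θ).fun_mul (hk1 θ)).deriv]; ring
  have d3 : deriv (fun θ => Real.exp (g θ) * ((k 1 θ - m) ^ 2 + k 2 θ))
      = fun θ => Real.exp (g θ) * ((k 1 θ - m) ^ 3 + 3 * (k 1 θ - m) * k 2 θ + k 3 θ) :=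
    funext fun θ => by
      rw [((hE θ).fun_mul (((hk1 θ).fun_pow 2).fun_add (hkd 2 θ))).deriv]; push_cast; ring
  have d4 : deriv (fun θ => Real.exp (g θ) * ((k 1 θ - m) ^ 3 + 3 * (k 1 θ - m) * k 2 θ + k 3 θ))
      = fun θ => Real.exp (g θ) * ((k 1 θ - m) ^ 4 + 6 * (k 1 θ - m) ^ 2 * k 2 θ
        + 4 * (k 1 θ - m) * k 3 θ + 3 * k 2 θ ^ 2 + k 4 θ) :=
    funext fun θ => by
      rw [((hE θ).fun_mul ((((hk1 θ).fun_pow 3).fun_add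
        (((hk1 θ).const_mul 3).fun_mul (hkd 2 θ))).fun_add (hkd 3 θ))).deriv]; push_cast; ring
  have h0W : (0 : ℝ) ∈ interior (integrableExpSet W P) := by rw [hWuniv]; simp
  refine ⟨fun n => integrable_pow_of_mem_interior_integrableExpSet h0W n, ?_, ?_⟩
  · have := iteratedDeriv_mgf_zero h0W 2
    rw [hmgf, iteratedDeriv_succ, iteratedDeriv_succ, iteratedDeriv_zero, d1, d2] at this
    simp only [hg0, hk10, Real.exp_zero, sub_self, hk0 2 two_ne_zero] at this
    simp only [Pi.pow_apply] at this
    rw [← this]; ring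
  · have := iteratedDeriv_mgf_zero h0W 4
    rw [hmgf, iteratedDeriv_succ, iteratedDeriv_succ, iteratedDeriv_succ, iteratedDeriv_succ,
      iteratedDeriv_zero, d1, d2, d3, d4] at this
    simp only [hg0, hk10, Real.exp_zero, sub_self, hk0 2 two_ne_zero, hk0 4 four_ne_zero] at this
    simp only [Pi.pow_apply] at this
    rw [← this]; ring

end ShotNoise

/-! ### Queue length as a Poisson count, and its covariance function -/

/-- The set of pairs (arrival epoch, service time) of the customers present at time `t`. -/
def active (t : ℝ) : Set (ℝ × ℝ) := {p | p.1 ≤ t ∧ t - p.1 < p.2}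

/-- The indicator function of `active t`. -/
noncomputable def activeInd (t : ℝ) (p : ℝ × ℝ) : ℝ := (active t).indicator 1 p

/-- The covariance function of the queue length. -/
noncomputable def covFun (lam : ℝ) (ν : Measure ℝ) (w : ℝ) : ℝ := lam * ∫ u, max (u - w) 0 ∂ν

/-- The centered queue length. -/
noncomputable def centered {Ω : Type*} (τ σ : ℤ → Ω → ℝ) (lam : ℝ) (ν : Measure ℝ) (t : ℝ)
    (ω : Ω) : ℝ := queueLength τ σ t ω - covFun lam ν 0

lemma measurableSet_active (t : ℝ) : MeasurableSet (active t) :=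
  (measurableSet_le measurable_fst measurable_const).inter
    (measurableSet_lt (measurable_const.sub measurable_fst) measurable_snd)

lemma measurable_activeInd (t : ℝ) : Measurable (activeInd t) :=
  measurable_one.indicator (measurableSet_active t)

lemma activeInd_nonneg (t : ℝ) (p : ℝ × ℝ) : 0 ≤ activeInd t p :=
  indicator_nonneg (fun _ _ => zero_le_one) p

lemma activeInd_le_one (t : ℝ) (p : ℝ × ℝ) : activeInd t p ≤ 1 :=
  indicator_le_self' (fun _ _ => zero_le_one) p

lemma activeInd_of_notMem {t : ℝ} {p : ℝ × ℝ} (h : p ∉ active t) : activeInd t p = 0 :=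
  indicator_of_notMem h _

lemma covFun_nonneg {lam : ℝ} {ν : Measure ℝ} (hlam : 0 ≤ lam) (w : ℝ) : 0 ≤ covFun lam ν w :=
  mul_nonneg hlam (integral_nonneg fun _ => le_max_right _ _)

section Intensity

variable {lam : ℝ} {ν : Measure ℝ} [IsProbabilityMeasure ν]

lemma integrable_max_sub (hν : Integrable (fun u => u) ν) (w : ℝ) :
    Integrable (fun u => max (u - w) 0) ν := (hν.sub (integrable_const w)).pos_part

/-- A customer with service time u is present at both s and t exactly when the arrival lies in (t -
u, s], an interval of length (u - (t - s))⁺. -/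
lemma intensity_active_inter (hlam : 0 ≤ lam) (hν : Integrable (fun u => u) ν) {s t : ℝ}
    (hst : s ≤ t) :
    intensity lam ν (active s ∩ active t) = ENNReal.ofReal (covFun lam ν (t - s)) := by
  have h1 : volume.prod ν (active s ∩ active t) = ∫⁻ u, ENNReal.ofReal (u - (t - s)) ∂ν := by
    rw [Measure.prod_apply_symm ((measurableSet_active s).inter (measurableSet_active t))]
    refine lintegral_congr fun u => ?_
    have : (fun x => (x, u)) ⁻¹' (active s ∩ active t) = Ioc (t - u) s := by
      ext x
      simp only [active, mem_preimage, mem_inter_iff, mem_ofPred_eq, mem_Ioc]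
      constructor
      · rintro ⟨⟨h1, h2⟩, h3, h4⟩; exact ⟨by linarith, h1⟩
      · rintro ⟨h1, h2⟩; exact ⟨⟨h2, by linarith⟩, by linarith, by linarith⟩
    rw [this, Real.volume_Ioc]
    congr 1; ring
  rw [intensity, Measure.smul_apply, h1, smul_eq_mul, covFun, ENNReal.ofReal_mul hlam,
    ofReal_integral_eq_lintegral_ofReal (integrable_max_sub hν _)
      (Filter.Eventually.of_forall fun u => le_max_right _ _)]
  congr 1
  refine lintegral_congr fun u => ?_
  rw [ENNReal.ofReal_max]
  simp

lemma intensity_active_ne_top (hlam : 0 ≤ lam) (hν : Integrable (fun u => u) ν) (t : ℝ) :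
    intensity lam ν (active t) ≠ ∞ := by
  have := intensity_active_inter hlam hν (le_refl t)
  rw [inter_self] at this
  rw [this]
  exact ENNReal.ofReal_ne_top

lemma integral_activeInd_mul (hlam : 0 ≤ lam) (hν : Integrable (fun u => u) ν) (s t : ℝ) :
    ∫ p, activeInd s p * activeInd t p ∂(intensity lam ν) = covFun lam ν |t - s| := by
  wlog h : s ≤ t generalizing s t
  · rw [abs_sub_comm, ← this t s (le_of_not_ge h)]
    simp only [mul_comm]
  have h1 : (fun p => activeInd s p * activeInd t p) = (active s ∩ active t).indicator 1 := by
    ext p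
    rw [activeInd, activeInd, ← inter_indicator_mul]
    simp only [Pi.one_apply, mul_one]
    rfl
  rw [h1, integral_indicator_one ((measurableSet_active s).inter (measurableSet_active t)),
    Measure.real, intensity_active_inter hlam hν h,
    ENNReal.toReal_ofReal (covFun_nonneg hlam _), abs_of_nonneg (sub_nonneg.2 h)]

lemma integral_activeInd (hlam : 0 ≤ lam) (hν : Integrable (fun u => u) ν) (t : ℝ) :
    ∫ p, activeInd t p ∂(intensity lam ν) = covFun lam ν 0 := by
  have h := integral_activeInd_mul hlam hν t t
  rw [sub_self, abs_zero] at h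
  rw [← h]
  congr 1
  ext p
  by_cases hp : p ∈ active t <;> simp [activeInd, hp]

lemma integrable_of_le_activeInd (hlam : 0 ≤ lam) (hν : Integrable (fun u => u) ν) (t b : ℝ)
    {g : ℝ × ℝ → ℝ} (hg : Measurable g) (hb : ∀ p, |g p| ≤ b)
    (hgA : ∀ p, p ∉ active t → g p = 0) : Integrable g (intensity lam ν) :=
  integrable_of_bounded_of_support (measurableSet_active t)
    (intensity_active_ne_top hlam hν t) hg hb hgA

/-- Two of the four indicators are bounded by 1. Keeping a and c retains decay in the distance
between the base points of two lagged products. -/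
lemma integral_prod_four_le (hlam : 0 ≤ lam) (hν : Integrable (fun u => u) ν) (a b c d : ℝ) :
    ∫ p, activeInd a p * activeInd b p * activeInd c p * activeInd d p ∂(intensity lam ν)
      ≤ covFun lam ν |c - a| := by
  rw [← integral_activeInd_mul hlam hν a c]
  have ha := measurable_activeInd a
  have hb := measurable_activeInd b
  have hc := measurable_activeInd c
  have hd := measurable_activeInd d
  have n0 := activeInd_nonneg
  have n1 := activeInd_le_one
  have hle : ∀ p, activeInd a p * activeInd b p * activeInd c p * activeInd d p
      ≤ activeInd a p * activeInd c p := fun p => by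
    calc activeInd a p * activeInd b p * activeInd c p * activeInd d p
        = activeInd a p * activeInd c p * (activeInd b p * activeInd d p) := by ring
      _ ≤ activeInd a p * activeInd c p * 1 :=
        mul_le_mul_of_nonneg_left (mul_le_one₀ (n1 b p) (n0 d p) (n1 d p))
          (mul_nonneg (n0 a p) (n0 c p))
      _ = _ := mul_one _
  have hac : ∀ p, activeInd a p * activeInd c p ≤ 1 := fun p =>
    mul_le_one₀ (n1 a p) (n0 c p) (n1 c p)
  refine integral_mono ?_ ?_ hle
  · refine integrable_of_le_activeInd hlam hν a 1 (by fun_prop) (fun p => ?_) fun p hp => by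
      simp [activeInd_of_notMem hp]
    rw [abs_of_nonneg (mul_nonneg (mul_nonneg (mul_nonneg (n0 a p) (n0 b p)) (n0 c p)) (n0 d p))]
    exact (hle p).trans (hac p)
  · refine integrable_of_le_activeInd hlam hν a 1 (by fun_prop) (fun p => ?_) fun p hp => by
      simp [activeInd_of_notMem hp]
    rw [abs_of_nonneg (mul_nonneg (n0 a p) (n0 c p))]
    exact hac p

lemma integral_sum_activeInd_sq (hlam : 0 ≤ lam) (hν : Integrable (fun u => u) ν) {ι : Type*}
    (s : Finset ι) (c t : ι → ℝ) :
    Integrable (fun p => (∑ i ∈ s, c i * activeInd (t i) p) ^ 2) (intensity lam ν) ∧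
    ∫ p, (∑ i ∈ s, c i * activeInd (t i) p) ^ 2 ∂(intensity lam ν)
      = ∑ i ∈ s, ∑ j ∈ s, c i * c j * covFun lam ν |t j - t i| := by
  have h2 : ∀ i j, Integrable (fun p => c i * c j * (activeInd (t i) p * activeInd (t j) p))
      (intensity lam ν) := fun i j => by
    refine Integrable.const_mul (integrable_of_le_activeInd hlam hν (t i) 1
      ((measurable_activeInd _).fun_mul (measurable_activeInd _)) (fun p => ?_) fun p hp => ?_) _
    · rw [abs_of_nonneg (mul_nonneg (activeInd_nonneg _ _) (activeInd_nonneg _ _))]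
      exact mul_le_one₀ (activeInd_le_one _ _) (activeInd_nonneg _ _) (activeInd_le_one _ _)
    · rw [activeInd_of_notMem hp, zero_mul]
  have h3 : ∀ p, (∑ i ∈ s, c i * activeInd (t i) p) ^ 2
      = ∑ i ∈ s, ∑ j ∈ s, c i * c j * (activeInd (t i) p * activeInd (t j) p) := by
    intro p
    rw [sq, Finset.sum_mul_sum]
    refine Finset.sum_congr rfl fun i _ => Finset.sum_congr rfl fun j _ => by ring
  simp only [h3]
  refine ⟨integrable_finsetSum s fun i _ => integrable_finsetSum s fun j _ => h2 i j, ?_⟩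
  rw [integral_finsetSum s fun i _ => integrable_finsetSum s fun j _ => h2 i j]
  refine Finset.sum_congr rfl fun i _ => ?_
  rw [integral_finsetSum s fun j _ => h2 i j]
  refine Finset.sum_congr rfl fun j _ => ?_
  rw [integral_const_mul, integral_activeInd_mul hlam hν]

end Intensity

section Measurability

variable {Ω : Type*} {lam : ℝ} {ν : Measure ℝ} {τ σ : ℤ → Ω → ℝ}

lemma queueLength_eq_tsum (τ σ : ℤ → Ω → ℝ) (t : ℝ) (ω : Ω) :
    queueLength τ σ t ω = ∑' j, activeInd t (τ j ω, σ j ω) := by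
  classical
  unfold queueLength
  refine tsum_congr fun j => ?_
  simp only [activeInd, active, indicator_apply, mem_ofPred_eq, Pi.one_apply]

variable [MeasurableSpace Ω] {P : Measure Ω}

lemma IsMGInfinity.measurable_queueLength (hq : IsMGInfinity P lam ν τ σ) (t : ℝ) :
    Measurable (queueLength τ σ t) := by
  have : queueLength τ σ t = fun ω => ∑' j, activeInd t (τ j ω, σ j ω) :=
    funext fun ω => queueLength_eq_tsum τ σ t ω
  rw [this]
  exact measurable_real_tsum (fun j => (measurable_activeInd t).comp
    ((hq.arrivals.measurable j).prodMk (hq.measurable_service j))) fun j ω => activeInd_nonneg _ _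

lemma IsMGInfinity.measurable_centered (hq : IsMGInfinity P lam ν τ σ) (t : ℝ) :
    Measurable (centered τ σ lam ν t) := (hq.measurable_queueLength t).sub_const _

end Measurability

/-! ### Joint second and fourth moments of the queue length -/

section Moments

variable {Ω : Type*} [MeasurableSpace Ω] {P : Measure Ω} [IsProbabilityMeasure P] {lam : ℝ}
  {ν : Measure ℝ} [IsProbabilityMeasure ν] {τ σ : ℤ → Ω → ℝ}

/-- Moments of nonnegative linear combinations of queue lengths. -/
lemma IsMGInfinity.moments_sum (hq : IsMGInfinity P lam ν τ σ) (hlam : 0 < lam)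
    (hν : Integrable (fun u => u) ν) {ι : Type*} (s : Finset ι) (c t : ι → ℝ) (hc : ∀ i, 0 ≤ c i) :
    (∀ n : ℕ, Integrable (fun ω => (∑ i ∈ s, c i * centered τ σ lam ν (t i) ω) ^ n) P) ∧
    ∫ ω, (∑ i ∈ s, c i * centered τ σ lam ν (t i) ω) ^ 2 ∂P
      = ∑ i ∈ s, ∑ j ∈ s, c i * c j * covFun lam ν |t j - t i| ∧
    ∫ ω, (∑ i ∈ s, c i * centered τ σ lam ν (t i) ω) ^ 4 ∂P
      = ∫ p, (∑ i ∈ s, c i * activeInd (t i) p) ^ 4 ∂(intensity lam ν)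
        + 3 * (∑ i ∈ s, ∑ j ∈ s, c i * c j * covFun lam ν |t j - t i|) ^ 2 := by
  set f : ℝ × ℝ → ℝ := fun p => ∑ i ∈ s, c i * activeInd (t i) p with hfdef
  have hf : Measurable f :=
    Finset.measurable_fun_sum s fun i _ => (measurable_activeInd (t i)).const_mul (c i)
  have hf0 : ∀ p, 0 ≤ f p := fun p =>
    Finset.sum_nonneg fun i _ => mul_nonneg (hc i) (activeInd_nonneg _ _)
  have hfb : ∀ p, f p ≤ ∑ i ∈ s, c i := fun p => Finset.sum_le_sum fun i _ =>
    mul_le_of_le_one_right (hc i) (activeInd_le_one _ _)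
  have hA : MeasurableSet (⋃ i ∈ s, active (t i)) :=
    s.measurableSet_biUnion fun i _ => measurableSet_active _
  have hΛ : intensity lam ν (⋃ i ∈ s, active (t i)) ≠ ∞ := by
    refine ne_top_of_le_ne_top ?_ (measure_biUnion_finset_le s _)
    exact ENNReal.sum_ne_top.2 fun i _ => intensity_active_ne_top hlam.le hν _
  have hfA : ∀ p, p ∉ (⋃ i ∈ s, active (t i)) → f p = 0 := by
    intro p hp
    simp only [mem_iUnion, not_exists] at hp
    exact Finset.sum_eq_zero fun i hi => by rw [activeInd_of_notMem (hp i hi), mul_zero]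
  have hint1 : ∀ i, Integrable (activeInd (t i)) (intensity lam ν) := fun i =>
    integrable_of_le_activeInd hlam.le hν (t i) 1 (measurable_activeInd _)
      (fun p => by rw [abs_of_nonneg (activeInd_nonneg _ _)]; exact activeInd_le_one _ _)
      fun p hp => activeInd_of_notMem hp
  have hm : ∫ p, f p ∂(intensity lam ν) = ∑ i ∈ s, c i * covFun lam ν 0 := by
    rw [hfdef, integral_finsetSum s fun i _ => (hint1 i).const_mul (c i)]
    refine Finset.sum_congr rfl fun i _ => ?_
    rw [integral_const_mul, integral_activeInd hlam.le hν]
  have hsq := (integral_sum_activeInd_sq hlam.le hν s c t).2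
  obtain ⟨h1, h2, h3⟩ := hq.central_moments hlam hf hf0 hfb hA hΛ hfA rfl
  -- Exchanging the series with the finite sum uses the almost sure summability of each queue
  -- length.
  have hae : ∀ᵐ ω ∂P, ∑' j, f (τ j ω, σ j ω) - ∫ p, f p ∂(intensity lam ν)
      = ∑ i ∈ s, c i * centered τ σ lam ν (t i) ω := by
    have hs : ∀ᵐ ω ∂P, ∀ i ∈ s, Summable fun j => activeInd (t i) (τ j ω, σ j ω) :=
      (Finset.eventually_all s).2 fun i _ =>
        hq.ae_summable hlam (measurable_activeInd (t i)) (activeInd_nonneg _)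
          (activeInd_le_one _) (measurableSet_active _) (intensity_active_ne_top hlam.le hν _)
          fun p hp => activeInd_of_notMem hp
    filter_upwards [hs] with ω hω
    rw [hm, hfdef]
    simp only
    rw [Summable.tsum_finsetSum fun i hi => (hω i hi).mul_left (c i), ← Finset.sum_sub_distrib]
    refine Finset.sum_congr rfl fun i _ => ?_
    rw [tsum_mul_left, centered, queueLength_eq_tsum, mul_sub]
  have hae' : ∀ n : ℕ, (fun ω => (∑' j, f (τ j ω, σ j ω) - ∫ p, f p ∂(intensity lam ν)) ^ n)
      =ᵐ[P] fun ω => (∑ i ∈ s, c i * centered τ σ lam ν (t i) ω) ^ n := fun n => by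
    filter_upwards [hae] with ω hω
    rw [hω]
  refine ⟨fun n => (h1 n).congr (hae' n), ?_, ?_⟩
  · rw [← integral_congr_ae (hae' 2), h2, hsq]
  · rw [← integral_congr_ae (hae' 4), h3, hsq]

/-- The covariances of the queue length. -/
lemma IsMGInfinity.integral_centered_mul (hq : IsMGInfinity P lam ν τ σ) (hlam : 0 < lam)
    (hν : Integrable (fun u => u) ν) (a b : ℝ) :
    Integrable (fun ω => centered τ σ lam ν a ω * centered τ σ lam ν b ω) P ∧
    ∫ ω, centered τ σ lam ν a ω * centered τ σ lam ν b ω ∂P = covFun lam ν |b - a| := by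
  obtain ⟨i2, m2, -⟩ := hq.moments_sum hlam hν Finset.univ (fun _ => 1) ![a, b]
    fun _ => zero_le_one
  obtain ⟨ia, ma, -⟩ := hq.moments_sum hlam hν (Finset.range 1) (fun _ => 1) (fun _ => a)
    fun _ => zero_le_one
  obtain ⟨ib, mb, -⟩ := hq.moments_sum hlam hν (Finset.range 1) (fun _ => 1) (fun _ => b)
    fun _ => zero_le_one
  have i2 := i2 2
  have ia := ia 2
  have ib := ib 2
  simp only [Fin.sum_univ_two, Matrix.cons_val_zero, Matrix.cons_val_one, one_mul,
    Finset.sum_range_one, sub_self, abs_zero] at i2 m2 ia ma ib mb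
  rw [abs_sub_comm a b] at m2
  have heq : (fun ω => centered τ σ lam ν a ω * centered τ σ lam ν b ω)
      = fun ω => (1 / 2) * (((centered τ σ lam ν a ω + centered τ σ lam ν b ω) ^ 2
        - centered τ σ lam ν a ω ^ 2) - centered τ σ lam ν b ω ^ 2) := by
    ext ω; ring
  have i2a : Integrable (fun ω => (centered τ σ lam ν a ω + centered τ σ lam ν b ω) ^ 2
      - centered τ σ lam ν a ω ^ 2) P := i2.sub ia
  refine ⟨heq ▸ (i2a.sub ib).const_mul _, ?_⟩
  rw [heq, integral_const_mul, integral_sub i2a ib, integral_sub i2 ia, m2, ma, mb]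
  ring

/-- Polarization with coefficients in {0, 1} rather than ±1, since the moment formula covers
nonnegative combinations only. -/
lemma polarization_four (y₁ y₂ y₃ y₄ : ℝ) :
    y₁ * y₂ * y₃ * y₄ = ∑ q ∈ Finset.range 2 ×ˢ Finset.range 2 ×ˢ Finset.range 2 ×ˢ Finset.range 2,
      (-1) ^ (q.1 + q.2.1 + q.2.2.1 + q.2.2.2) / 24
        * (q.1 * y₁ + q.2.1 * y₂ + q.2.2.1 * y₃ + q.2.2.2 * y₄) ^ 4 := by
  simp only [Finset.sum_product, Finset.sum_range_succ, Finset.sum_range_zero]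
  push_cast
  ring

/-- The same alternating sum applied to 3Q², with Q the variance of the combination. The diagonal
terms cancel, and the three Gaussian pairings remain. -/
lemma polarization_two_two (r₁₁ r₂₂ r₃₃ r₄₄ r₁₂ r₁₃ r₁₄ r₂₃ r₂₄ r₃₄ : ℝ) :
    r₁₂ * r₃₄ + r₁₃ * r₂₄ + r₁₄ * r₂₃
      = ∑ q ∈ Finset.range 2 ×ˢ Finset.range 2 ×ˢ Finset.range 2 ×ˢ Finset.range 2,
        (-1) ^ (q.1 + q.2.1 + q.2.2.1 + q.2.2.2) / 24
          * (3 * ((q.1 : ℝ) ^ 2 * r₁₁ + q.2.1 ^ 2 * r₂₂ + q.2.2.1 ^ 2 * r₃₃ + q.2.2.2 ^ 2 * r₄₄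
            + 2 * (q.1 * q.2.1 * r₁₂ + q.1 * q.2.2.1 * r₁₃ + q.1 * q.2.2.2 * r₁₄
              + q.2.1 * q.2.2.1 * r₂₃ + q.2.1 * q.2.2.2 * r₂₄ + q.2.2.1 * q.2.2.2 * r₃₄)) ^ 2) := by
  simp only [Finset.sum_product, Finset.sum_range_succ, Finset.sum_range_zero]
  push_cast
  ring

/-- The joint fourth central moments of the queue length. -/
lemma IsMGInfinity.integral_centered_four (hq : IsMGInfinity P lam ν τ σ) (hlam : 0 < lam)
    (hν : Integrable (fun u => u) ν) (a b c d : ℝ) :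
    Integrable (fun ω => centered τ σ lam ν a ω * centered τ σ lam ν b ω
      * centered τ σ lam ν c ω * centered τ σ lam ν d ω) P ∧
    ∫ ω, centered τ σ lam ν a ω * centered τ σ lam ν b ω
      * centered τ σ lam ν c ω * centered τ σ lam ν d ω ∂P
      = ∫ p, activeInd a p * activeInd b p * activeInd c p * activeInd d p ∂(intensity lam ν)
        + (covFun lam ν |b - a| * covFun lam ν |d - c| + covFun lam ν |c - a| * covFun lam ν |d - b|
          + covFun lam ν |d - a| * covFun lam ν |c - b|) := by
  have key : ∀ q : ℕ × ℕ × ℕ × ℕ,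
      Integrable (fun ω => (q.1 * centered τ σ lam ν a ω + q.2.1 * centered τ σ lam ν b ω
        + q.2.2.1 * centered τ σ lam ν c ω + q.2.2.2 * centered τ σ lam ν d ω) ^ 4) P ∧
      ∫ ω, (q.1 * centered τ σ lam ν a ω + q.2.1 * centered τ σ lam ν b ω
        + q.2.2.1 * centered τ σ lam ν c ω + q.2.2.2 * centered τ σ lam ν d ω) ^ 4 ∂P
      = ∫ p, (q.1 * activeInd a p + q.2.1 * activeInd b p + q.2.2.1 * activeInd c p
          + q.2.2.2 * activeInd d p) ^ 4 ∂(intensity lam ν)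
        + 3 * ((q.1 : ℝ) ^ 2 * covFun lam ν 0 + q.2.1 ^ 2 * covFun lam ν 0
            + q.2.2.1 ^ 2 * covFun lam ν 0 + q.2.2.2 ^ 2 * covFun lam ν 0
            + 2 * (q.1 * q.2.1 * covFun lam ν |b - a| + q.1 * q.2.2.1 * covFun lam ν |c - a|
              + q.1 * q.2.2.2 * covFun lam ν |d - a| + q.2.1 * q.2.2.1 * covFun lam ν |c - b|
              + q.2.1 * q.2.2.2 * covFun lam ν |d - b|
              + q.2.2.1 * q.2.2.2 * covFun lam ν |d - c|)) ^ 2 := by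
    intro q
    obtain ⟨i4, -, m4⟩ := hq.moments_sum hlam hν Finset.univ
      ![(q.1 : ℝ), (q.2.1 : ℝ), (q.2.2.1 : ℝ), (q.2.2.2 : ℝ)] ![a, b, c, d]
      (by intro i; fin_cases i <;> simp)
    have i4 := i4 4
    simp only [Fin.sum_univ_four, Matrix.cons_val, sub_self, abs_zero] at i4 m4
    refine ⟨i4, ?_⟩
    rw [m4, abs_sub_comm a b, abs_sub_comm a c, abs_sub_comm a d, abs_sub_comm b c,
      abs_sub_comm b d, abs_sub_comm c d]
    congr 3
    ring
  have hΛ : ∀ q : ℕ × ℕ × ℕ × ℕ, Integrable (fun p => (q.1 * activeInd a p + q.2.1 * activeInd b p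
      + q.2.2.1 * activeInd c p + q.2.2.2 * activeInd d p) ^ 4) (intensity lam ν) := by
    intro q
    have ma := measurable_activeInd a
    have mb := measurable_activeInd b
    have mc := measurable_activeInd c
    have md := measurable_activeInd d
    refine integrable_of_bounded_of_support (A := active a ∪ active b ∪ active c ∪ active d)
      (b := ((q.1 : ℝ) + q.2.1 + q.2.2.1 + q.2.2.2) ^ 4)
      ((((measurableSet_active a).union (measurableSet_active b)).union
        (measurableSet_active c)).union (measurableSet_active d)) ?_ (by fun_prop) ?_ ?_
    · simp [measure_union_eq_top_iff, intensity_active_ne_top hlam.le hν]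
    · intro p
      have h0 : ∀ (n : ℕ) t, 0 ≤ n * activeInd t p := fun n t =>
        mul_nonneg n.cast_nonneg (activeInd_nonneg t p)
      have h1 : ∀ (n : ℕ) t, n * activeInd t p ≤ n := fun n t =>
        mul_le_of_le_one_right n.cast_nonneg (activeInd_le_one t p)
      rw [abs_of_nonneg (by positivity)]
      refine pow_le_pow_left₀ ?_ ?_ 4
      · linarith [h0 q.1 a, h0 q.2.1 b, h0 q.2.2.1 c, h0 q.2.2.2 d]
      · linarith [h1 q.1 a, h1 q.2.1 b, h1 q.2.2.1 c, h1 q.2.2.2 d]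
    · intro p hp
      simp only [mem_union, not_or] at hp
      simp [activeInd_of_notMem hp.1.1.1, activeInd_of_notMem hp.1.1.2,
        activeInd_of_notMem hp.1.2, activeInd_of_notMem hp.2]
  rw [polarization_two_two (covFun lam ν 0) (covFun lam ν 0) (covFun lam ν 0) (covFun lam ν 0)]
  simp only [polarization_four]
  refine ⟨integrable_finsetSum _ fun q _ => (key q).1.const_mul _, ?_⟩
  rw [integral_finsetSum _ fun q _ => (key q).1.const_mul _,
    integral_finsetSum _ fun q _ => (hΛ q).const_mul _, ← Finset.sum_add_distrib]
  refine Finset.sum_congr rfl fun q _ => ?_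
  rw [integral_const_mul, integral_const_mul, (key q).2, mul_add]

end Moments

/-! ### Summability of covariances from the second moment -/

section ServiceMoments

variable {ν : Measure ℝ} {K lam δ : ℝ}

/-- The consequences of membership in the second moment class. -/
structure HasSecondMoment (ν : Measure ℝ) (K : ℝ) : Prop where
  prob : IsProbabilityMeasure ν
  nonneg : ∀ᵐ u ∂ν, 0 ≤ u
  integrable : Integrable (fun u => u) ν
  integrable_sq : Integrable (fun u => u ^ 2) ν
  sq_le : ∫ u, u ^ 2 ∂ν ≤ K
  mean_le : ∫ u, u ∂ν ≤ √K

lemma hasSecondMoment_of_mem (hK : 0 ≤ K) (h : ν ∈ momentClass 2 K) : HasSecondMoment ν K := by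
  obtain ⟨⟨hp, h0⟩, hm⟩ := h
  have hsq : ∫⁻ x, ENNReal.ofReal (x ^ 2) ∂ν ≤ ENNReal.ofReal K := by
    refine le_trans (le_of_eq ?_) hm
    simp
  have hi : Integrable (fun u : ℝ => u ^ 2) ν := by
    refine ⟨by fun_prop, ?_⟩
    rw [hasFiniteIntegral_iff_ofReal (Filter.Eventually.of_forall fun u => sq_nonneg u)]
    exact hsq.trans_lt ENNReal.ofReal_lt_top
  have hmem : MemLp (fun u : ℝ => u) 2 ν := (memLp_two_iff_integrable_sq (by fun_prop)).2 hi
  have hle : ∫ u, u ^ 2 ∂ν ≤ K := by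
    rw [integral_eq_lintegral_of_nonneg_ae (Filter.Eventually.of_forall fun u => sq_nonneg u)
      (by fun_prop)]
    exact ENNReal.toReal_le_of_le_ofReal hK hsq
  have hi1 : Integrable (fun u : ℝ => u) ν := hmem.integrable (by norm_num)
  refine ⟨hp, ?_, hi1, hi, hle, ?_⟩
  · rw [ae_iff]
    convert h0 using 2
    ext u; simp
  · refine Real.le_sqrt_of_sq_le (le_trans ?_ hle)
    have := variance_nonneg (fun u : ℝ => u) ν
    rw [variance_eq_sub hmem] at this
    simp only [Pi.pow_apply] at this
    linarith

lemma HasSecondMoment.covFun_zero_le (h : HasSecondMoment ν K) (hlam : 0 ≤ lam) :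
    covFun lam ν 0 ≤ lam * √K := by
  refine mul_le_mul_of_nonneg_left (le_trans (le_of_eq ?_) h.mean_le) hlam
  refine integral_congr_ae ?_
  filter_upwards [h.nonneg] with u hu
  simp [hu]

lemma covFun_antitone [IsProbabilityMeasure ν] (hν : Integrable (fun u => u) ν) (hlam : 0 ≤ lam) :
    Antitone (covFun lam ν) := fun a b hab => by
  refine mul_le_mul_of_nonneg_left (integral_mono (integrable_max_sub hν b)
    (integrable_max_sub hν a) fun u => ?_) hlam
  exact max_le_max (by linarith) le_rfl

/-- The left side is a Riemann sum of the triangle v ↦ (u - |v|)⁺, whose area is u². The subtracted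
square is the tail not yet summed; carrying it makes the induction telescope. -/
lemma sum_Icc_max_sub_le {u : ℝ} (hu : 0 ≤ u) (hδ : 0 ≤ δ) (M : ℕ) :
    ∑ m ∈ Finset.Icc (-(M : ℤ)) M, δ * max (u - |(m : ℝ) * δ|) 0
      ≤ u ^ 2 + δ * u - max (u - M * δ) 0 ^ 2 := by
  induction M with
  | zero => simp [hu]
  | succ M ih =>
    have hI : Finset.Icc (-((M + 1 : ℕ) : ℤ)) ((M + 1 : ℕ) : ℤ)
        = insert ((M + 1 : ℕ) : ℤ) (insert (-((M + 1 : ℕ) : ℤ)) (Finset.Icc (-(M : ℤ)) M)) := by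
      ext m
      simp only [Finset.mem_insert, Finset.mem_Icc]
      omega
    rw [hI, Finset.sum_insert (by simp; omega), Finset.sum_insert (by simp)]
    have habs : |((M + 1 : ℕ) : ℝ) * δ| = (M + 1) * δ := by
      push_cast
      exact abs_of_nonneg (by positivity)
    simp only [Int.cast_neg, Int.cast_natCast, neg_mul, abs_neg, habs]
    -- With s = u - (M + 1)δ ≥ 0 this is 2δs ≤ (s + δ)² - s².
    have hstep : 2 * (δ * max (u - (M + 1) * δ) 0)
        ≤ max (u - M * δ) 0 ^ 2 - max (u - (M + 1) * δ) 0 ^ 2 := by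
      rcases le_total 0 (u - (M + 1) * δ) with h | h
      · rw [max_eq_left h, max_eq_left (by nlinarith)]
        nlinarith
      · rw [max_eq_right h]
        simp
    push_cast
    linarith

lemma HasSecondMoment.sum_covFun_le (h : HasSecondMoment ν K) (hlam : 0 ≤ lam) (hδ : 0 < δ)
    (hδK : δ ≤ √K) (F : Finset ℤ) :
    ∑ m ∈ F, covFun lam ν |(m : ℝ) * δ| ≤ 2 * lam * K / δ := by
  have := h.prob
  have hK : 0 ≤ K := (integral_nonneg fun u => sq_nonneg u).trans h.sq_le
  obtain ⟨M, hM⟩ : ∃ M : ℕ, F ⊆ Finset.Icc (-(M : ℤ)) M := by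
    refine ⟨F.sup Int.natAbs, fun j hj => ?_⟩
    have := Finset.le_sup (f := Int.natAbs) hj
    rw [Finset.mem_Icc]
    omega
  refine (Finset.sum_le_sum_of_subset_of_nonneg hM fun m _ _ => covFun_nonneg hlam _).trans ?_
  rw [le_div_iff₀ hδ, Finset.sum_mul]
  have h1 : ∑ m ∈ Finset.Icc (-(M : ℤ)) M, covFun lam ν |(m : ℝ) * δ| * δ
      = lam * ∫ u, ∑ m ∈ Finset.Icc (-(M : ℤ)) M, δ * max (u - |(m : ℝ) * δ|) 0 ∂ν := by
    rw [integral_finsetSum _ fun m _ => (integrable_max_sub h.integrable _).const_mul δ,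
      Finset.mul_sum]
    refine Finset.sum_congr rfl fun m _ => ?_
    rw [integral_const_mul, covFun]
    ring
  rw [h1]
  have h2 : ∫ u, ∑ m ∈ Finset.Icc (-(M : ℤ)) M, δ * max (u - |(m : ℝ) * δ|) 0 ∂ν
      ≤ ∫ u, (u ^ 2 + δ * u) ∂ν := by
    refine integral_mono_ae (integrable_finsetSum _ fun m _ =>
      (integrable_max_sub h.integrable _).const_mul δ)
      (h.integrable_sq.add (h.integrable.const_mul δ)) ?_
    filter_upwards [h.nonneg] with u hu
    have := sum_Icc_max_sub_le hu hδ.le M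
    have := sq_nonneg (max (u - M * δ) 0)
    linarith
  have h3 : ∫ u, (u ^ 2 + δ * u) ∂ν ≤ 2 * K := by
    rw [integral_add h.integrable_sq (h.integrable.const_mul δ), integral_const_mul]
    -- The condition δ ≤ √K enters here: the discretization error is at most K, like the main term.
    have h4 : δ * ∫ u, u ∂ν ≤ √K * √K := by
      refine mul_le_mul hδK h.mean_le ?_ (Real.sqrt_nonneg K)
      exact integral_nonneg_of_ae h.nonneg
    rw [Real.mul_self_sqrt hK] at h4
    linarith [h.sq_le]
  calc _ ≤ lam * (2 * K) := mul_le_mul_of_nonneg_left (h2.trans h3) hlam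
    _ = _ := by ring

lemma HasSecondMoment.sum_Icc_covFun_le (h : HasSecondMoment ν K) (hlam : 0 ≤ lam) (hδ : 0 < δ)
    (hδK : δ ≤ √K) (N : ℕ) (c : ℤ) :
    ∑ j ∈ Finset.Icc 1 N, covFun lam ν |((j : ℝ) + c) * δ| ≤ 2 * lam * K / δ := by
  have := h.sum_covFun_le hlam hδ hδK ((Finset.Icc 1 N).map
    ⟨fun j : ℕ => (j : ℤ) + c, fun a b hab => by simpa using hab⟩)
  rw [Finset.sum_map] at this
  refine le_trans (le_of_eq (Finset.sum_congr rfl fun j _ => ?_)) this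
  change _ = covFun lam ν |(((j : ℤ) + c : ℤ) : ℝ) * δ|
  push_cast
  rfl

end ServiceMoments

/-! ### Mean squared error of the empirical covariances -/

section Covariance

variable {Ω : Type*} [MeasurableSpace Ω] {P : Measure Ω} [IsProbabilityMeasure P] {lam δ K : ℝ}
  {ν : Measure ℝ} {τ σ : ℤ → Ω → ℝ}

/-- Fourth moment of an average of the centered queue length. -/
lemma IsMGInfinity.integral_average_four_le (hq : IsMGInfinity P lam ν τ σ) (hlam : 0 < lam)
    (h : HasSecondMoment ν K) (hδ : 0 < δ) (hδK : δ ≤ √K) {N : ℕ} (hN : 0 < N) (c : ℕ) :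
    Integrable (fun ω => (∑ i ∈ Finset.Icc 1 N,
      1 / (N : ℝ) * centered τ σ lam ν (((i + c : ℕ) : ℝ) * δ) ω) ^ 4) P ∧
    ∫ ω, (∑ i ∈ Finset.Icc 1 N,
      1 / (N : ℝ) * centered τ σ lam ν (((i + c : ℕ) : ℝ) * δ) ω) ^ 4 ∂P
      ≤ (1 + 3 * covFun lam ν 0) * (2 * lam * K / δ) / N := by
  have := h.prob
  have hN' : (0 : ℝ) < N := by exact_mod_cast hN
  obtain ⟨hi, -, h4⟩ := hq.moments_sum hlam h.integrable (Finset.Icc 1 N) (fun _ => 1 / (N : ℝ))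
    (fun i => ((i + c : ℕ) : ℝ) * δ) fun _ => by positivity
  obtain ⟨f2, m2⟩ := integral_sum_activeInd_sq hlam.le h.integrable (Finset.Icc 1 N)
    (fun _ => 1 / (N : ℝ)) (fun i => ((i + c : ℕ) : ℝ) * δ)
  refine ⟨hi 4, ?_⟩
  rw [h4, ← m2]
  set f : ℝ × ℝ → ℝ := fun p =>
    ∑ i ∈ Finset.Icc 1 N, 1 / (N : ℝ) * activeInd (((i + c : ℕ) : ℝ) * δ) p with hf
  have hf0 : ∀ p, 0 ≤ f p := fun p =>
    Finset.sum_nonneg fun i _ => mul_nonneg (by positivity) (activeInd_nonneg _ _)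
  have hf1 : ∀ p, f p ≤ 1 := fun p => by
    calc f p ≤ ∑ i ∈ Finset.Icc 1 N, 1 / (N : ℝ) := Finset.sum_le_sum fun i _ =>
          mul_le_of_le_one_right (by positivity) (activeInd_le_one _ _)
      _ = 1 := by simp [hN'.ne']
  -- An average of indicators lies in [0, 1], so the fourth cumulant is at most the variance v. In
  -- 3v², one factor v is later bounded by R(0) and the other by (2λK/δ)/N.
  have h42 : ∫ p, f p ^ 4 ∂(intensity lam ν) ≤ ∫ p, f p ^ 2 ∂(intensity lam ν) :=
    integral_mono_of_nonneg (Filter.Eventually.of_forall fun p => pow_nonneg (hf0 p) 4) f2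
      (Filter.Eventually.of_forall fun p =>
        pow_le_pow_of_le_one (hf0 p) (hf1 p) (by norm_num))
  have hpair : ∀ i j : ℕ, covFun lam ν |((j + c : ℕ) : ℝ) * δ - ((i + c : ℕ) : ℝ) * δ|
      = covFun lam ν |((j : ℝ) + (-(i : ℤ) : ℤ)) * δ| := by
    intro i j
    congr 2
    push_cast
    ring
  simp only [hpair] at m2
  have hr0 := covFun_nonneg (ν := ν) hlam.le 0
  set v := ∫ p, f p ^ 2 ∂(intensity lam ν) with hv
  have hv0 : 0 ≤ v := integral_nonneg fun p => sq_nonneg _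
  have hv1 : v ≤ (2 * lam * K / δ) / N := by
    rw [m2]
    calc _ = ∑ i ∈ Finset.Icc 1 N, 1 / (N : ℝ) * (1 / (N : ℝ)) *
          ∑ j ∈ Finset.Icc 1 N, covFun lam ν |((j : ℝ) + (-(i : ℤ) : ℤ)) * δ| := by
          simp only [Finset.mul_sum]
      _ ≤ ∑ i ∈ Finset.Icc 1 N, 1 / (N : ℝ) * (1 / (N : ℝ)) * (2 * lam * K / δ) :=
          Finset.sum_le_sum fun i _ => mul_le_mul_of_nonneg_left
            (h.sum_Icc_covFun_le hlam.le hδ hδK N _) (by positivity)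
      _ = _ := by
          rw [Finset.sum_const, Nat.card_Icc, nsmul_eq_mul, Nat.add_sub_cancel]
          field_simp
  have hv2 : v ≤ covFun lam ν 0 := by
    rw [m2]
    calc _ ≤ ∑ i ∈ Finset.Icc 1 N, ∑ j ∈ Finset.Icc 1 N,
          1 / (N : ℝ) * (1 / (N : ℝ)) * covFun lam ν 0 :=
          Finset.sum_le_sum fun i _ => Finset.sum_le_sum fun j _ => mul_le_mul_of_nonneg_left
            (covFun_antitone h.integrable hlam.le (abs_nonneg _)) (by positivity)
      _ = _ := by
          simp only [Finset.sum_const, Nat.card_Icc, nsmul_eq_mul, Nat.add_sub_cancel]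
          field_simp
  calc ∫ p, f p ^ 4 ∂(intensity lam ν) + 3 * v ^ 2 ≤ v + 3 * v * v := by linarith
    _ ≤ v + 3 * v * covFun lam ν 0 := by gcongr
    _ = (1 + 3 * covFun lam ν 0) * v := by ring
    _ ≤ (1 + 3 * covFun lam ν 0) * ((2 * lam * K / δ) / N) := by gcongr
    _ = _ := by ring

/-- Variance of the empirical average of lagged products of the centered queue length. -/
lemma IsMGInfinity.integral_lagged_sq_le (hq : IsMGInfinity P lam ν τ σ) (hlam : 0 < lam)
    (h : HasSecondMoment ν K) (hδ : 0 < δ) (hδK : δ ≤ √K) {N : ℕ} (hN : 0 < N) (k : ℕ) :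
    Integrable (fun ω => (1 / (N : ℝ) * ∑ i ∈ Finset.Icc 1 N,
      (centered τ σ lam ν ((i : ℝ) * δ) ω * centered τ σ lam ν (((i + k : ℕ) : ℝ) * δ) ω
        - covFun lam ν (k * δ))) ^ 2) P ∧
    ∫ ω, (1 / (N : ℝ) * ∑ i ∈ Finset.Icc 1 N,
      (centered τ σ lam ν ((i : ℝ) * δ) ω * centered τ σ lam ν (((i + k : ℕ) : ℝ) * δ) ω
        - covFun lam ν (k * δ))) ^ 2 ∂P
      ≤ (1 + 2 * covFun lam ν 0) * (2 * lam * K / δ) / N := by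
  have := h.prob
  have hN' : (0 : ℝ) < N := by exact_mod_cast hN
  set H := covFun lam ν (k * δ) with hH
  set Y : ℕ → Ω → ℝ := fun i => centered τ σ lam ν ((i : ℝ) * δ) with hY
  have hr0 := covFun_nonneg (ν := ν) hlam.le 0
  have hHk : ∀ i : ℕ, covFun lam ν |((i + k : ℕ) : ℝ) * δ - (i : ℝ) * δ| = H := by
    intro i
    rw [hH]
    congr 1
    push_cast
    rw [show ((i : ℝ) + k) * δ - i * δ = k * δ by ring, abs_of_nonneg (by positivity)]
  have h2 : ∀ i, Integrable (fun ω => Y i ω * Y (i + k) ω) P ∧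
      ∫ ω, Y i ω * Y (i + k) ω ∂P = H := fun i => by
    have := hq.integral_centered_mul hlam h.integrable ((i : ℝ) * δ) (((i + k : ℕ) : ℝ) * δ)
    rwa [hHk] at this
  -- Of the three pairings, the one within each lagged product equals H² and is removed by
  -- centering. In each of the others one covariance is bounded by R(0), and the remaining one is
  -- summable in j.
  have h4 : ∀ i j : ℕ, Integrable (fun ω => (Y i ω * Y (i + k) ω - H) *
        (Y j ω * Y (j + k) ω - H)) P ∧
      ∫ ω, (Y i ω * Y (i + k) ω - H) * (Y j ω * Y (j + k) ω - H) ∂P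
        ≤ (1 + covFun lam ν 0) * covFun lam ν |((j : ℝ) + (-(i : ℤ) : ℤ)) * δ|
          + covFun lam ν 0 * covFun lam ν |((j : ℝ) + ((k : ℤ) - (i : ℤ) : ℤ)) * δ| := by
    intro i j
    obtain ⟨i4, m4⟩ := hq.integral_centered_four hlam h.integrable ((i : ℝ) * δ)
      (((i + k : ℕ) : ℝ) * δ) ((j : ℝ) * δ) (((j + k : ℕ) : ℝ) * δ)
    have heq : (fun ω => (Y i ω * Y (i + k) ω - H) * (Y j ω * Y (j + k) ω - H))
        = fun ω => ((Y i ω * Y (i + k) ω * Y j ω * Y (j + k) ω - H * (Y i ω * Y (i + k) ω))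
          - H * (Y j ω * Y (j + k) ω)) + H ^ 2 := by
      ext ω; ring
    have ia : Integrable (fun ω => Y i ω * Y (i + k) ω * Y j ω * Y (j + k) ω
        - H * (Y i ω * Y (i + k) ω)) P := i4.sub ((h2 i).1.const_mul H)
    have ib : Integrable (fun ω => Y i ω * Y (i + k) ω * Y j ω * Y (j + k) ω
        - H * (Y i ω * Y (i + k) ω) - H * (Y j ω * Y (j + k) ω)) P :=
      ia.sub ((h2 j).1.const_mul H)
    refine ⟨heq ▸ ib.add (integrable_const _), ?_⟩
    rw [heq, integral_add ib (integrable_const _), integral_sub ia ((h2 j).1.const_mul H),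
      integral_sub i4 ((h2 i).1.const_mul H), integral_const_mul, integral_const_mul, (h2 i).2,
      (h2 j).2, integral_const, probReal_univ, one_smul, m4, hHk, hHk]
    have hF := integral_prod_four_le hlam.le h.integrable ((i : ℝ) * δ)
      (((i + k : ℕ) : ℝ) * δ) ((j : ℝ) * δ) (((j + k : ℕ) : ℝ) * δ)
    have e1 : covFun lam ν |(j : ℝ) * δ - (i : ℝ) * δ|
        = covFun lam ν |((j : ℝ) + (-(i : ℤ) : ℤ)) * δ| := by
      congr 2; push_cast; ring
    have e2 : covFun lam ν |((j + k : ℕ) : ℝ) * δ - ((i + k : ℕ) : ℝ) * δ|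
        = covFun lam ν |((j : ℝ) + (-(i : ℤ) : ℤ)) * δ| := by
      congr 2; push_cast; ring
    have e3 : covFun lam ν |((j + k : ℕ) : ℝ) * δ - (i : ℝ) * δ|
        = covFun lam ν |((j : ℝ) + ((k : ℤ) - (i : ℤ) : ℤ)) * δ| := by
      congr 2; push_cast; ring
    rw [e1] at hF ⊢
    rw [e2, e3]
    have ha := covFun_antitone h.integrable hlam.le
      (abs_nonneg (((j : ℝ) + (-(i : ℤ) : ℤ)) * δ))
    have hb := covFun_antitone h.integrable hlam.le
      (abs_nonneg ((j : ℝ) * δ - ((i + k : ℕ) : ℝ) * δ))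
    have hc := covFun_nonneg (ν := ν) hlam.le |((j : ℝ) + (-(i : ℤ) : ℤ)) * δ|
    have hd := covFun_nonneg (ν := ν) hlam.le |((j : ℝ) + ((k : ℤ) - (i : ℤ) : ℤ)) * δ|
    nlinarith [mul_le_mul_of_nonneg_right ha hc, mul_le_mul_of_nonneg_left hb hd]
  have hexp : ∀ ω, (1 / (N : ℝ) * ∑ i ∈ Finset.Icc 1 N, (Y i ω * Y (i + k) ω - H)) ^ 2
      = (1 / (N : ℝ)) ^ 2 * ∑ i ∈ Finset.Icc 1 N, ∑ j ∈ Finset.Icc 1 N,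
        (Y i ω * Y (i + k) ω - H) * (Y j ω * Y (j + k) ω - H) := by
    intro ω
    rw [mul_pow, sq (∑ i ∈ Finset.Icc 1 N, (Y i ω * Y (i + k) ω - H)), Finset.sum_mul_sum]
  have hS := h.sum_Icc_covFun_le hlam.le hδ hδK N
  simp only [hY] at hexp h4 ⊢
  simp only [hexp]
  refine ⟨(integrable_finsetSum _ fun i _ => integrable_finsetSum _ fun j _ =>
    (h4 i j).1).const_mul _, ?_⟩
  rw [integral_const_mul, integral_finsetSum _ fun i _ => integrable_finsetSum _ fun j _ =>
    (h4 i j).1]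
  have hrow : ∀ i ∈ Finset.Icc 1 N, ∫ ω, ∑ j ∈ Finset.Icc 1 N,
      (centered τ σ lam ν ((i : ℝ) * δ) ω * centered τ σ lam ν (((i + k : ℕ) : ℝ) * δ) ω - H) *
      (centered τ σ lam ν ((j : ℝ) * δ) ω * centered τ σ lam ν (((j + k : ℕ) : ℝ) * δ) ω - H) ∂P
      ≤ (1 + 2 * covFun lam ν 0) * (2 * lam * K / δ) := by
    intro i _
    rw [integral_finsetSum _ fun j _ => (h4 i j).1]
    refine (Finset.sum_le_sum fun j _ => (h4 i j).2).trans ?_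
    rw [Finset.sum_add_distrib, ← Finset.mul_sum, ← Finset.mul_sum]
    have h5 := mul_le_mul_of_nonneg_left (hS (-(i : ℤ))) (by linarith : 0 ≤ 1 + covFun lam ν 0)
    have h6 := mul_le_mul_of_nonneg_left (hS ((k : ℤ) - (i : ℤ))) hr0
    linarith
  calc _ ≤ (1 / (N : ℝ)) ^ 2 * ∑ i ∈ Finset.Icc 1 N,
        (1 + 2 * covFun lam ν 0) * (2 * lam * K / δ) :=
        mul_le_mul_of_nonneg_left (Finset.sum_le_sum hrow) (by positivity)
    _ = _ := by
        rw [Finset.sum_const, Nat.card_Icc, nsmul_eq_mul, Nat.add_sub_cancel]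
        field_simp

/-- Both factors are centered by the mean of the first n - k observations only. The two terms
quadratic in that mean cancel, leaving the product of the averages of the first and of the last n -
k values. The unknown ρ drops out. -/
lemma RHat_eq (n k : ℕ) (hk : k < n) (x y : ℕ → ℝ) (ρ : ℝ) (hx : ∀ i, x i = y i + ρ) :
    RHat n x k = 1 / ((n - k : ℕ) : ℝ) * ∑ i ∈ Finset.Icc 1 (n - k), y i * y (i + k)
      - (∑ i ∈ Finset.Icc 1 (n - k), 1 / ((n - k : ℕ) : ℝ) * y i)
        * ∑ i ∈ Finset.Icc 1 (n - k), 1 / ((n - k : ℕ) : ℝ) * y (i + k) := by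
  have hN : ((n - k : ℕ) : ℝ) = (n : ℝ) - k := Nat.cast_sub hk.le
  have hpos : ((n - k : ℕ) : ℝ) ≠ 0 := by
    have : n - k ≠ 0 := by omega
    exact_mod_cast this
  have hρ : rhoHat n x k = 1 / ((n - k : ℕ) : ℝ) * ∑ i ∈ Finset.Icc 1 (n - k), y i + ρ := by
    rw [rhoHat, ← hN]
    simp only [hx, Finset.sum_add_distrib, Finset.sum_const, Nat.card_Icc, nsmul_eq_mul,
      Nat.add_sub_cancel]
    field_simp
  rw [RHat, ← hN]
  set N := ((n - k : ℕ) : ℝ)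
  rw [← Finset.mul_sum, ← Finset.mul_sum]
  set A := ∑ i ∈ Finset.Icc 1 (n - k), y i with hA
  set B := ∑ i ∈ Finset.Icc 1 (n - k), y (i + k) with hB
  have : ∑ i ∈ Finset.Icc 1 (n - k), (x i - rhoHat n x k) * (x (i + k) - rhoHat n x k)
      = ∑ i ∈ Finset.Icc 1 (n - k), y i * y (i + k) - 1 / N * A * B - 1 / N * A * A
        + N * (1 / N * A) ^ 2 := by
    have hterm : ∀ i, (x i - rhoHat n x k) * (x (i + k) - rhoHat n x k)
        = y i * y (i + k) - 1 / N * A * y (i + k) - 1 / N * A * y i + (1 / N * A) ^ 2 := by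
      intro i
      rw [hρ, hx, hx]
      ring
    simp only [hterm, Finset.sum_add_distrib, Finset.sum_sub_distrib, ← Finset.mul_sum,
      Finset.sum_const, Nat.card_Icc, nsmul_eq_mul, Nat.add_sub_cancel]
    rfl
  rw [this]
  field_simp
  ring

/-- The mean squared error of the empirical covariance. -/
lemma IsMGInfinity.integral_RHat_sub_sq_le (hq : IsMGInfinity P lam ν τ σ) (hlam : 0 < lam)
    (h : HasSecondMoment ν K) (hδ : 0 < δ) (hδK : δ ≤ √K) {n k : ℕ} (hk : k < n) :
    Integrable (fun ω => (RHat n (sample τ σ δ ω) k - covFun lam ν (k * δ)) ^ 2) P ∧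
    ∫ ω, (RHat n (sample τ σ δ ω) k - covFun lam ν (k * δ)) ^ 2 ∂P
      ≤ 20 * lam ^ 2 * (K * max (√K) 1 * (1 + 1 / lam)) / (((n : ℝ) - k) * δ) := by
  have := h.prob
  have hK : 0 ≤ K := (integral_nonneg fun u => sq_nonneg u).trans h.sq_le
  have hN : 0 < n - k := by omega
  have hN' : (0 : ℝ) < ((n - k : ℕ) : ℝ) := by exact_mod_cast hN
  obtain ⟨iU, mU⟩ := hq.integral_lagged_sq_le hlam h hδ hδK hN k
  obtain ⟨iA, mA⟩ := hq.integral_average_four_le hlam h hδ hδK hN 0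
  obtain ⟨iB, mB⟩ := hq.integral_average_four_le hlam h hδ hδK hN k
  have hx : ∀ ω (i : ℕ), sample τ σ δ ω i
      = centered τ σ lam ν ((i : ℝ) * δ) ω + covFun lam ν 0 := fun ω i => by
    simp [sample, centered]
  have hR := fun ω => RHat_eq n k hk (sample τ σ δ ω) _ _ (hx ω)
  simp only [Nat.add_zero] at iA mA
  set U : Ω → ℝ := fun ω => 1 / ((n - k : ℕ) : ℝ) * ∑ i ∈ Finset.Icc 1 (n - k),
      (centered τ σ lam ν ((i : ℝ) * δ) ω * centered τ σ lam ν (((i + k : ℕ) : ℝ) * δ) ω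
        - covFun lam ν (k * δ)) with hU
  set A : Ω → ℝ := fun ω => ∑ i ∈ Finset.Icc 1 (n - k),
      1 / ((n - k : ℕ) : ℝ) * centered τ σ lam ν ((i : ℝ) * δ) ω with hA
  set B : Ω → ℝ := fun ω => ∑ i ∈ Finset.Icc 1 (n - k),
      1 / ((n - k : ℕ) : ℝ) * centered τ σ lam ν (((i + k : ℕ) : ℝ) * δ) ω with hB
  have hdec : ∀ ω, RHat n (sample τ σ δ ω) k - covFun lam ν (k * δ) = U ω - A ω * B ω := by
    intro ω
    rw [hR ω, hU]
    simp only [Finset.sum_sub_distrib, Finset.sum_const, Nat.card_Icc, nsmul_eq_mul,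
      Nat.add_sub_cancel]
    rw [mul_sub, ← mul_assoc (1 / ((n - k : ℕ) : ℝ)) ((n - k : ℕ) : ℝ),
      one_div_mul_cancel hN'.ne', one_mul]
    ring
  -- (U - AB)² ≤ 2U² + 2A²B² ≤ 2U² + A⁴ + B⁴.
  have hle : ∀ ω, (RHat n (sample τ σ δ ω) k - covFun lam ν (k * δ)) ^ 2
      ≤ 2 * U ω ^ 2 + (A ω ^ 4 + B ω ^ 4) := by
    intro ω
    rw [hdec ω]
    nlinarith [sq_nonneg (U ω + A ω * B ω), sq_nonneg (A ω ^ 2 - B ω ^ 2)]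
  have hbound : Integrable (fun ω => 2 * U ω ^ 2 + (A ω ^ 4 + B ω ^ 4)) P :=
    (iU.const_mul 2).add (iA.add iB)
  have hmeas : Measurable fun ω => (RHat n (sample τ σ δ ω) k - covFun lam ν (k * δ)) ^ 2 := by
    simp only [hdec]
    have hm := fun t => hq.measurable_centered (ν := ν) t
    exact ((((Finset.measurable_fun_sum _ fun i _ => ((hm _).mul (hm _)).sub_const _).const_mul
      _).sub ((Finset.measurable_fun_sum _ fun i _ => (hm _).const_mul _).mul
        (Finset.measurable_fun_sum _ fun i _ => (hm _).const_mul _))).pow_const 2)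
  refine ⟨hbound.mono' hmeas.aestronglyMeasurable (Filter.Eventually.of_forall fun ω => by
    rw [Real.norm_of_nonneg (sq_nonneg _)]; exact hle ω), ?_⟩
  have iAB : Integrable (fun ω => A ω ^ 4 + B ω ^ 4) P := iA.add iB
  have h1 : ∫ ω, (RHat n (sample τ σ δ ω) k - covFun lam ν (k * δ)) ^ 2 ∂P
      ≤ 2 * ∫ ω, U ω ^ 2 ∂P + (∫ ω, A ω ^ 4 ∂P + ∫ ω, B ω ^ 4 ∂P) := by
    rw [← integral_add iA iB, ← integral_const_mul, ← integral_add (iU.const_mul 2) iAB]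
    exact integral_mono_of_nonneg (Filter.Eventually.of_forall fun ω => sq_nonneg _) hbound
      (Filter.Eventually.of_forall hle)
  have hr0 := covFun_nonneg (ν := ν) hlam.le 0
  have hr1 := h.covFun_zero_le hlam.le
  have hcast : (n : ℝ) - k = ((n - k : ℕ) : ℝ) := (Nat.cast_sub hk.le).symm
  rw [hcast]
  set N := ((n - k : ℕ) : ℝ)
  have hS : 0 ≤ 2 * lam * K / δ / N := by positivity
  -- The constants add up to 2(1 + 2R(0)) + 2(1 + 3R(0)) = 4 + 10R(0), and R(0) ≤ λ√K.
  have h2 : (4 + 10 * covFun lam ν 0) ≤ 10 * ((1 + lam) * max (√K) 1) := by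
    have ha := le_max_left (√K) 1
    have hb := le_max_right (√K) 1
    nlinarith [mul_le_mul_of_nonneg_left ha hlam.le]
  calc _ ≤ (4 + 10 * covFun lam ν 0) * (2 * lam * K / δ / N) := by
        refine h1.trans ?_
        have e1 : (1 + 2 * covFun lam ν 0) * (2 * lam * K / δ) / N
          = (1 + 2 * covFun lam ν 0) * (2 * lam * K / δ / N) := by ring
        have e2 : (1 + 3 * covFun lam ν 0) * (2 * lam * K / δ) / N
          = (1 + 3 * covFun lam ν 0) * (2 * lam * K / δ / N) := by ring
        rw [e1] at mU
        rw [e2] at mA mB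
        linarith
    _ ≤ 10 * ((1 + lam) * max (√K) 1) * (2 * lam * K / δ / N) := by gcongr
    _ = _ := by field_simp; ring

end Covariance

/-! ### Numerical differentiation formulas and optimal weights -/

section Differentiation

open Polynomial

/-- A differentiation formula at `x` on `ℓ + 1` well separated nodes. -/
lemma exists_stencil (ℓ : ℕ) (hℓ : 1 ≤ ℓ) (v : ℕ → ℝ) (x : ℝ) {D E : ℝ} (hD : 0 < D)
    (hE : 0 ≤ E) (hv : ∀ i j, i ≠ j → D ≤ |v i - v j|) (hx : ∀ i ≤ ℓ, |x - v i| ≤ E) :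
    ∃ w : ℕ → ℝ, (∀ i ≤ ℓ, |w i| ≤ ℓ * E ^ (ℓ - 1) / D ^ ℓ) ∧
      ∀ p : ℝ[X], p.natDegree ≤ ℓ →
        ∑ i ∈ Finset.range (ℓ + 1), w i * p.eval (v i) = (derivative p).eval x := by
  have hinj : Set.InjOn v (Finset.range (ℓ + 1)) := by
    intro i _ j _ hij
    by_contra hne
    have := hv i j hne
    rw [hij, sub_self, abs_zero] at this
    linarith
  -- The weight is the derivative at x of the i-th Lagrange basis polynomial. Its numerator has ℓ
  -- terms, each a product of ℓ - 1 distances.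
  refine ⟨fun i => (∑ t ∈ ((Finset.range (ℓ + 1)).erase i).powersetCard (ℓ - 1),
    ∏ a ∈ t, (x - v a)) / ∏ j ∈ (Finset.range (ℓ + 1)).erase i, (v i - v j), ?_, ?_⟩
  · intro i hi
    have hi' : i ∈ Finset.range (ℓ + 1) := Finset.mem_range.2 (by omega)
    have hcard : ((Finset.range (ℓ + 1)).erase i).card = ℓ := by
      rw [Finset.card_erase_of_mem hi', Finset.card_range]; rfl
    rw [abs_div]
    refine div_le_div₀ (by positivity) ?_ (by positivity) ?_
    · refine (Finset.abs_sum_le_sum_abs _ _).trans ?_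
      have h1 : ∀ t ∈ ((Finset.range (ℓ + 1)).erase i).powersetCard (ℓ - 1),
          |∏ a ∈ t, (x - v a)| ≤ E ^ (ℓ - 1) := by
        intro t ht
        obtain ⟨ht1, ht2⟩ := Finset.mem_powersetCard.1 ht
        rw [Finset.abs_prod, ← ht2, ← Finset.prod_const]
        refine Finset.prod_le_prod (fun _ _ => abs_nonneg _) fun a ha => hx a ?_
        have := Finset.mem_range.1 (Finset.mem_of_mem_erase (ht1 ha))
        omega
      refine (Finset.sum_le_card_nsmul _ _ _ h1).trans (le_of_eq ?_)
      rw [Finset.card_powersetCard, hcard, nsmul_eq_mul, Nat.choose_symm hℓ, Nat.choose_one_right]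
    · have hDp : D ^ ℓ = ∏ _j ∈ (Finset.range (ℓ + 1)).erase i, D := by
        rw [Finset.prod_const, hcard]
      rw [Finset.abs_prod, hDp]
      exact Finset.prod_le_prod (fun _ _ => hD.le) fun j hj =>
        hv i j (Finset.ne_of_mem_erase hj).symm
  · intro p hp
    have hdeg : p.degree < (Finset.range (ℓ + 1)).card := by
      rw [Finset.card_range]
      exact (degree_le_natDegree).trans_lt (by exact_mod_cast Nat.lt_succ_of_le hp)
    have := Lagrange.eval_iterate_derivative_eq_sum hinj hdeg (k := 1)
      (by rw [Finset.card_range]; omega) x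
    simp only [Function.iterate_one, Nat.factorial_one, Nat.cast_one, one_mul,
      Finset.card_range] at this
    rw [this]
    refine Finset.sum_congr rfl fun i _ => ?_
    rw [show ℓ + 1 - (1 + 1) = ℓ - 1 by omega]
    ring

lemma sum_range_mul_eq (f : ℕ → ℝ) (a q : ℕ) :
    ∑ k ∈ Finset.range (a * q), f k
      = ∑ r ∈ Finset.range q, ∑ i ∈ Finset.range a, f (r + i * q) := by
  rw [Finset.sum_comm]
  induction a with
  | zero => simp
  | succ a ih =>
    rw [Finset.sum_range_succ, Nat.succ_mul, Finset.sum_range_add, ih]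
    simp only [add_comm]

/-- Averaged differentiation formulas on a block of equidistant nodes. -/
lemma exists_block_weights (ℓ : ℕ) (hℓ : 1 ≤ ℓ) (S : Finset ℕ) (k₁ q : ℕ) (hq : 0 < q)
    {δ x E : ℝ} (hδ : 0 < δ) (hE : 0 ≤ E)
    (hS : ∀ k < (ℓ + 1) * q, k₁ + k ∈ S) (hx : ∀ k ∈ S, |x - k * δ| ≤ E) :
    ∃ b : ℕ → ℝ, (∀ k, |b k| ≤ ℓ * E ^ (ℓ - 1) / (q * δ) ^ ℓ / q) ∧
      ∀ p : ℝ[X], p.natDegree ≤ ℓ →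
        ∑ k ∈ S, b k * p.eval (k * δ) = (derivative p).eval x := by
  have hq' : (0 : ℝ) < q := by exact_mod_cast hq
  have hblock : ∀ r < q, ∀ i ≤ ℓ, r + i * q < (ℓ + 1) * q := by
    intro r hr i hi
    calc r + i * q < q + i * q := by omega
      _ = (i + 1) * q := by ring
      _ ≤ (ℓ + 1) * q := Nat.mul_le_mul_right q (by omega)
  -- Each residue class mod q in the block provides ℓ + 1 nodes with spacing qδ, hence one stencil.
  have hst : ∀ r : ℕ, ∃ w : ℕ → ℝ, r < q → (∀ i ≤ ℓ, |w i| ≤ ℓ * E ^ (ℓ - 1) / (q * δ) ^ ℓ) ∧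
      ∀ p : ℝ[X], p.natDegree ≤ ℓ → ∑ i ∈ Finset.range (ℓ + 1),
        w i * p.eval (((k₁ + (r + i * q) : ℕ) : ℝ) * δ) = (derivative p).eval x := by
    intro r
    by_cases hr : r < q
    · obtain ⟨w, hw⟩ := exists_stencil ℓ hℓ (fun i => ((k₁ + (r + i * q) : ℕ) : ℝ) * δ) x
        (D := q * δ) (E := E) (by positivity) hE (fun i j hij => by
          rw [← sub_mul, abs_mul, abs_of_pos hδ]
          refine mul_le_mul_of_nonneg_right ?_ hδ.le
          push_cast
          rw [show ((k₁ : ℝ) + (r + i * q) - (k₁ + (r + j * q))) = (i - j) * q by ring, abs_mul,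
            abs_of_pos hq']
          have h1 : (1 : ℝ) ≤ |(i : ℝ) - j| := by
            have : (1 : ℤ) ≤ |(i : ℤ) - j| := Int.one_le_abs (by omega)
            exact_mod_cast this
          nlinarith) fun i hi => hx _ (hS _ (hblock r hr i hi))
      exact ⟨w, fun _ => hw⟩
    · exact ⟨0, fun h => absurd h hr⟩
  choose w hw using hst
  -- The average of the q stencils. Their node sets partition the block, so every node receives a
  -- single stencil weight divided by q.
  set b : ℕ → ℝ := fun k => if k₁ ≤ k ∧ k < k₁ + (ℓ + 1) * q
    then w ((k - k₁) % q) ((k - k₁) / q) / q else 0 with hb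
  refine ⟨b, ?_, ?_⟩
  · intro k
    simp only [hb]
    split_ifs with hk
    · rw [abs_div, abs_of_pos hq']
      refine div_le_div_of_nonneg_right ?_ hq'.le
      refine (hw _ (Nat.mod_lt _ hq)).1 _ ?_
      have : (k - k₁) / q < ℓ + 1 := (Nat.div_lt_iff_lt_mul hq).2 (by omega)
      omega
    · rw [abs_zero]; positivity
  · intro p hp
    have hsub : (Finset.range ((ℓ + 1) * q)).map (addLeftEmbedding k₁) ⊆ S := by
      intro k hk
      simp only [Finset.mem_map, Finset.mem_range, addLeftEmbedding_apply] at hk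
      obtain ⟨a, ha, rfl⟩ := hk
      exact hS a ha
    rw [← Finset.sum_subset hsub, Finset.sum_map]
    · simp only [addLeftEmbedding_apply]
      rw [sum_range_mul_eq]
      have hrow : ∀ r ∈ Finset.range q, ∑ i ∈ Finset.range (ℓ + 1),
          b (k₁ + (r + i * q)) * p.eval (((k₁ + (r + i * q) : ℕ) : ℝ) * δ)
          = (derivative p).eval x / q := by
        intro r hr
        have hr := Finset.mem_range.1 hr
        rw [← (hw r hr).2 p hp, Finset.sum_div]
        refine Finset.sum_congr rfl fun i hi => ?_
        have hi : i ≤ ℓ := by have := Finset.mem_range.1 hi; omega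
        have := hblock r hr i hi
        simp only [hb]
        rw [if_pos ⟨by omega, by omega⟩, Nat.add_sub_cancel_left, Nat.add_mul_mod_self_right,
          Nat.mod_eq_of_lt hr, Nat.add_mul_div_right _ _ hq, Nat.div_eq_of_lt hr, zero_add]
        ring
      rw [Finset.sum_congr rfl hrow, Finset.sum_const, Finset.card_range, nsmul_eq_mul]
      field_simp
    · intro k _ hk
      have : ¬ (k₁ ≤ k ∧ k < k₁ + (ℓ + 1) * q) := by
        rintro ⟨h1, h2⟩
        refine hk ?_
        simp only [Finset.mem_map, Finset.mem_range, addLeftEmbedding_apply]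
        exact ⟨k - k₁, by omega, by omega⟩
      simp only [hb]
      rw [if_neg this, zero_mul]

/-- Feasible weights differentiate polynomials. -/
lemma feasible_iff (n ℓ : ℕ) (δ h x : ℝ) (a : ℕ → ℝ) :
    Feasible n ℓ δ h x a ↔ ∀ p : ℝ[X], p.natDegree ≤ ℓ →
      ∑ k ∈ windowIdx n δ h x, a k * p.eval (k * δ) = (derivative p).eval x := by
  constructor
  · rintro ⟨h0, h1⟩ p hp
    have hmom : ∀ j ≤ ℓ, ∑ k ∈ windowIdx n δ h x, a k * ((k : ℝ) * δ) ^ j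
        = (j : ℝ) * x ^ (j - 1) := by
      intro j hj
      rcases Nat.eq_zero_or_pos j with rfl | hj0
      · simpa using h0
      · exact h1 j (Finset.mem_Icc.2 ⟨hj0, hj⟩)
    have hp' : p.natDegree < ℓ + 1 := by omega
    have hdp : (derivative p).eval x
        = ∑ j ∈ Finset.range (ℓ + 1), p.coeff j * ((j : ℝ) * x ^ (j - 1)) := by
      rw [derivative_eval, p.sum_over_range' (by simp) (ℓ + 1) hp']
      refine Finset.sum_congr rfl fun j _ => by ring
    rw [hdp]
    simp only [eval_eq_sum_range' hp', Finset.mul_sum]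
    rw [Finset.sum_comm]
    refine Finset.sum_congr rfl fun j hj => ?_
    rw [← hmom j (by have := Finset.mem_range.1 hj; omega), Finset.mul_sum]
    exact Finset.sum_congr rfl fun k _ => by ring
  · intro H
    refine ⟨?_, fun j hj => ?_⟩
    · simpa using H 1 (by simp)
    · have := H (X ^ j) (by simpa using (Finset.mem_Icc.1 hj).2)
      simpa [derivative_X_pow] using this

end Differentiation

/-- Optimal weights exist as soon as the constraints can be met. -/
lemma exists_isOptimalWeight {n ℓ : ℕ} {δ h x : ℝ} {b : ℕ → ℝ} (hb : Feasible n ℓ δ h x b) :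
    ∃ a, IsOptimalWeight n ℓ δ h x a := by
  classical
  set S := windowIdx n δ h x with hS
  let ext : EuclideanSpace ℝ S → ℕ → ℝ := fun v k => if hk : k ∈ S then v ⟨k, hk⟩ else 0
  have hext : ∀ v (k : S), ext v k = v k := fun v k => by simp [ext]
  let res : (ℕ → ℝ) → EuclideanSpace ℝ S := fun a => WithLp.toLp 2 fun k => a k
  have hsum : ∀ v (c : ℕ → ℝ), ∑ k ∈ S, ext v k * c k = ∑ k : S, v k * c k := fun v c => by
    rw [← Finset.sum_coe_sort]
    exact Finset.sum_congr rfl fun k _ => by rw [hext]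
  have hcong : ∀ a a' : ℕ → ℝ, (∀ k ∈ S, a k = a' k) → Feasible n ℓ δ h x a →
      Feasible n ℓ δ h x a' := by
    rintro a a' haa ⟨h1, h2⟩
    refine ⟨?_, fun j hj => ?_⟩
    · rw [← h1]; exact Finset.sum_congr rfl fun k hk => (haa k hk).symm
    · rw [← h2 j hj]; exact Finset.sum_congr rfl fun k hk => by rw [haa k hk]
  have hcl : IsClosed {v : EuclideanSpace ℝ S | Feasible n ℓ δ h x (ext v)} := by
    have hc : ∀ c : ℕ → ℝ, Continuous fun v : EuclideanSpace ℝ S => ∑ k : S, v k * c k :=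
      fun c => by fun_prop
    have h1 : ∀ v, Feasible n ℓ δ h x (ext v) ↔ (∑ k : S, v k * 1 = 0 ∧
        ∀ j ∈ Finset.Icc 1 ℓ, ∑ k : S, v k * ((k : ℕ) * δ) ^ j = (j : ℝ) * x ^ (j - 1)) := by
      intro v
      simp only [Feasible, ← hS]
      rw [← hsum v fun _ => 1]
      simp only [hsum v fun k => ((k : ℝ) * δ) ^ _, mul_one]
    simp only [h1, ofPred_and, ofPred_forall]
    exact (isClosed_eq (hc fun _ => 1) continuous_const).inter (isClosed_iInter fun j =>
      isClosed_iInter fun _ => isClosed_eq (hc fun k => ((k : ℝ) * δ) ^ j) continuous_const)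
  have hne : {v : EuclideanSpace ℝ S | Feasible n ℓ δ h x (ext v)}.Nonempty :=
    ⟨res b, hcong b _ (fun k hk => by simp [ext, res, hk]) hb⟩
  -- A nonempty closed set in a Euclidean space has a point nearest to 0, that is, one of least sum
  -- of squares.
  obtain ⟨v, hv, hmin⟩ := hcl.exists_infDist_eq_dist hne 0
  refine ⟨ext v, hv, fun b' hb' => ?_⟩
  have hmem : res b' ∈ {v : EuclideanSpace ℝ S | Feasible n ℓ δ h x (ext v)} :=
    hcong b' _ (fun k hk => by simp [ext, res, hk]) hb'
  have hle : dist 0 v ≤ dist 0 (res b') := hmin ▸ Metric.infDist_le_dist_of_mem hmem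
  rw [dist_zero_left, dist_zero_left, ← sq_le_sq₀ (norm_nonneg _) (norm_nonneg _),
    EuclideanSpace.real_norm_sq_eq, EuclideanSpace.real_norm_sq_eq] at hle
  rw [← Finset.sum_coe_sort, ← Finset.sum_coe_sort S fun k => b' k ^ 2]
  simpa only [hext] using hle

/-! ### The window and the absolute sum of the weights -/

section Window

variable {n ℓ : ℕ} {δ h x : ℝ}

/-- The right-end window may start below 0, but by at most δ, because x + h < nδ. -/
lemma window_eq_Icc (hδ : 0 < δ) (hx : h ≤ x) (hxn : x + h < n * δ) :
    ∃ lo, window n δ h x = Icc lo (lo + 2 * h) ∧ -δ ≤ lo ∧ lo + 2 * h ≤ n * δ := by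
  unfold window
  split_ifs with h1 h2
  · exact ⟨0, by simp, by linarith, by linarith⟩
  · exact ⟨x - h, by congr 1; ring, by linarith, by linarith⟩
  · exact ⟨n * δ - δ - 2 * h, by congr 1; ring, by linarith, by linarith⟩

/-- Since h ≤ x, the left-end case occurs only for x = h and is symmetric about x. In the right-end
case the window is shifted left by less than δ, so some nodes may lie slightly below x - h. -/
lemma mem_windowIdx_cases (hδ : 0 < δ) (hx : h ≤ x) (hxn : x + h < n * δ) {k : ℕ}
    (hk : k ∈ windowIdx n δ h x) :
    k < n ∧ k * δ ≤ x + h ∧ x - h - δ < k * δ ∧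
      (x - h ≤ k * δ ∨ n * δ - δ < x + h) := by
  classical
  obtain ⟨hk1, hk2⟩ := Finset.mem_filter.1 hk
  have hlt : (k : ℝ) * δ < n * δ → k < n := fun hh => by
    exact_mod_cast lt_of_mul_lt_mul_right hh hδ.le
  unfold window at hk2
  split_ifs at hk2 with h1 h2
  · have hxh : x = h := le_antisymm h1 hx
    obtain ⟨h3, h4⟩ := hk2
    exact ⟨hlt (by linarith), by linarith, by linarith, Or.inl (by linarith)⟩
  · obtain ⟨h3, h4⟩ := hk2
    exact ⟨hlt (by linarith), by linarith, by linarith, Or.inl (by linarith)⟩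
  · obtain ⟨h3, h4⟩ := hk2
    exact ⟨hlt (by linarith), by linarith, by linarith, Or.inr (by linarith)⟩

lemma card_windowIdx_le (hδ : 0 < δ) (hh : 0 < h) (hx : h ≤ x) (hxn : x + h < n * δ) :
    ((windowIdx n δ h x).card : ℝ) ≤ 2 * h / δ + 1 := by
  classical
  rcases (windowIdx n δ h x).eq_empty_or_nonempty with he | hne
  · rw [he]; simp; positivity
  obtain ⟨lo, hlo, -, -⟩ := window_eq_Icc hδ hx hxn
  have hmem : ∀ k ∈ windowIdx n δ h x, lo ≤ k * δ ∧ k * δ ≤ lo + 2 * h := fun k hk => by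
    have := (Finset.mem_filter.1 hk).2
    rwa [hlo] at this
  have hsub : windowIdx n δ h x ⊆ Finset.Icc ((windowIdx n δ h x).min' hne)
      ((windowIdx n δ h x).max' hne) := fun k hk =>
    Finset.mem_Icc.2 ⟨Finset.min'_le _ _ hk, Finset.le_max' _ _ hk⟩
  have hcard := Finset.card_le_card hsub
  rw [Nat.card_Icc] at hcard
  have hm := hmem _ (Finset.min'_mem _ hne)
  have hM := hmem _ (Finset.max'_mem _ hne)
  have hmM := Finset.min'_le_max' _ hne
  set m := (windowIdx n δ h x).min' hne
  set M := (windowIdx n δ h x).max' hne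
  have h1 : ((windowIdx n δ h x).card : ℝ) ≤ M - m + 1 := by
    have : (windowIdx n δ h x).card + m ≤ M + 1 := by omega
    have : ((windowIdx n δ h x).card : ℝ) + m ≤ M + 1 := by exact_mod_cast this
    linarith
  have h2 : (M : ℝ) - m ≤ 2 * h / δ := by
    rw [le_div_iff₀ hδ]
    linarith
  linarith

/-- The window contains a long block of indices. -/
lemma exists_block_subset (hδ : 0 < δ) (hx : h ≤ x) (hxn : x + h < n * δ)
    (hδh : (ℓ + 2) * δ ≤ 2 * h) :
    ∃ k₁ q : ℕ, 0 < q ∧ h ≤ (ℓ + 2) * (q * δ) ∧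
      ∀ k < (ℓ + 1) * q, k₁ + k ∈ windowIdx n δ h x := by
  classical
  obtain ⟨lo, hlo, hlo1, hlo2⟩ := window_eq_Icc hδ hx hxn
  -- Room is made for (ℓ + 2)q nodes but only (ℓ + 1)q are used. The spare length qδ ≥ δ absorbs a
  -- negative left end and the rounding to the grid. From y ≥ 1 follows y < q + 1 ≤ 2q, whence h ≤
  -- (ℓ + 2)qδ.
  set y := 2 * h / ((ℓ + 2) * δ) with hy
  have hy1 : 1 ≤ y := (one_le_div (by positivity)).2 hδh
  have hyh : y * ((ℓ + 2) * δ) = 2 * h := div_mul_cancel₀ _ (by positivity)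
  set q := ⌊y⌋₊ with hq
  have hq1 : 1 ≤ q := Nat.one_le_floor_iff y |>.2 hy1
  have hq1' : (1 : ℝ) ≤ q := by exact_mod_cast hq1
  have hqy : (q : ℝ) ≤ y := Nat.floor_le (by linarith)
  have hyq : y < q + 1 := Nat.lt_floor_add_one y
  have hqh : (ℓ + 2) * (q * δ) ≤ 2 * h := by
    rw [← hyh]
    have : (q : ℝ) * ((ℓ + 2) * δ) ≤ y * ((ℓ + 2) * δ) := by gcongr
    linarith
  have hpos : 0 < (ℓ + 2) * δ := by positivity
  refine ⟨⌊max lo 0 / δ⌋₊ + 1, q, hq1, ?_, ?_⟩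
  · nlinarith
  · intro k hk
    set f := ⌊max lo 0 / δ⌋₊ with hf
    have hf1 : (f : ℝ) * δ ≤ max lo 0 := by
      rw [← le_div_iff₀ hδ]
      exact Nat.floor_le (by positivity)
    have hf2 : max lo 0 < (f + 1) * δ := by
      rw [← div_lt_iff₀ hδ]
      exact Nat.lt_floor_add_one _
    have hk' : (k : ℝ) + 1 ≤ (ℓ + 1) * q := by
      have : k + 1 ≤ (ℓ + 1) * q := hk
      exact_mod_cast this
    have hkq : ((k : ℝ) + 1) * δ ≤ 2 * h - q * δ := by
      have := mul_le_mul_of_nonneg_right hk' hδ.le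
      nlinarith
    have hδq : δ ≤ q * δ := by nlinarith
    have hm1 : max lo 0 ≤ lo + δ := max_le (by linarith) (by linarith)
    have hcast : ((f + 1 + k : ℕ) : ℝ) * δ = f * δ + (k + 1) * δ := by push_cast; ring
    have hup : ((f + 1 + k : ℕ) : ℝ) * δ ≤ lo + 2 * h := by rw [hcast]; linarith
    have hn : f + 1 + k ≤ n := by
      have : ((f + 1 + k : ℕ) : ℝ) * δ ≤ n * δ := hup.trans hlo2
      exact_mod_cast le_of_mul_le_mul_right this hδ
    refine Finset.mem_filter.2 ⟨Finset.mem_Icc.2 ⟨by omega, hn⟩, ?_⟩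
    rw [hlo]
    refine ⟨?_, hup⟩
    have hlm := le_max_left lo 0
    have hkδ : 0 ≤ (k : ℝ) * δ := by positivity
    rw [hcast]
    linarith

/-- Existence of optimal weights and the bound of their absolute sum. -/
lemma weights_bound (hℓ : 1 ≤ ℓ) (hδ : 0 < δ) (hh : 0 < h) (hx : h ≤ x) (hxn : x + h < n * δ)
    (hδh : (ℓ + 2) * δ ≤ 2 * h) :
    (∃ a, IsOptimalWeight n ℓ δ h x a) ∧
    ∀ a, IsOptimalWeight n ℓ δ h x a → ∑ k ∈ windowIdx n δ h x, |a k|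
      ≤ 3 * (ℓ * 2 ^ (ℓ - 1) * (ℓ + 2) ^ (ℓ + 1)) / h := by
  obtain ⟨k₁, q, hq, hqh, hblock⟩ := exists_block_subset hδ hx hxn hδh
  have hq' : (0 : ℝ) < q := by exact_mod_cast hq
  have hℓ' : (1 : ℝ) ≤ ℓ := by exact_mod_cast hℓ
  have hδ2 : δ ≤ h := by nlinarith
  have hE : ∀ k ∈ windowIdx n δ h x, |x - k * δ| ≤ 2 * h := by
    intro k hk
    obtain ⟨-, h1, h2, -⟩ := mem_windowIdx_cases hδ hx hxn hk
    rw [abs_le]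
    constructor <;> linarith
  obtain ⟨b, hb1, hb2⟩ := exists_block_weights ℓ hℓ _ k₁ q hq hδ (by positivity : 0 ≤ 2 * h)
    hblock hE
  have hbf : Feasible n ℓ δ h x b := (feasible_iff n ℓ δ h x b).2 hb2
  refine ⟨exists_isOptimalWeight hbf, fun a ha => ?_⟩
  set B : ℝ := ℓ * 2 ^ (ℓ - 1) * (ℓ + 2) ^ (ℓ + 1) with hB
  have hB0 : 0 ≤ B := by positivity
  have hbB : ∀ k, |b k| ≤ B * δ / h ^ 2 := by
    intro k
    refine (hb1 k).trans ?_
    have h1 : 1 / (q * δ) ≤ (ℓ + 2) / h := by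
      rw [div_le_div_iff₀ (by positivity) hh]; linarith
    calc ℓ * (2 * h) ^ (ℓ - 1) / (q * δ) ^ ℓ / q
        = ℓ * (2 * h) ^ (ℓ - 1) * (1 / (q * δ)) ^ (ℓ + 1) * δ := by
          rw [pow_succ, div_pow, one_pow]; field_simp
      _ ≤ ℓ * (2 * h) ^ (ℓ - 1) * ((ℓ + 2) / h) ^ (ℓ + 1) * δ := by gcongr
      _ = B * δ / h ^ 2 := by
          obtain ⟨m, rfl⟩ : ∃ m, ℓ = m + 1 := ⟨ℓ - 1, by omega⟩
          rw [hB, Nat.add_sub_cancel, mul_pow, div_pow]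
          field_simp
          ring
  have hcard : ((windowIdx n δ h x).card : ℝ) ≤ 3 * h / δ := by
    refine (card_windowIdx_le hδ hh hx hxn).trans ?_
    have : 1 ≤ h / δ := (one_le_div hδ).2 hδ2
    calc 2 * h / δ + 1 ≤ 2 * h / δ + h / δ := by linarith
      _ = _ := by ring
  have hsqb : ∑ k ∈ windowIdx n δ h x, b k ^ 2 ≤ 3 * h / δ * (B * δ / h ^ 2) ^ 2 := by
    calc _ ≤ ∑ k ∈ windowIdx n δ h x, (B * δ / h ^ 2) ^ 2 := Finset.sum_le_sum fun k _ => by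
          rw [← sq_abs]; exact pow_le_pow_left₀ (abs_nonneg _) (hbB k) 2
      _ ≤ _ := by rw [Finset.sum_const, nsmul_eq_mul]; gcongr
  have hsqa := (ha.2 b hbf).trans hsqb
  -- Optimality controls only ∑ a_k²; Cauchy–Schwarz with at most 3h/δ nodes converts it into a
  -- bound on ∑ |a_k|.
  have hcs : (∑ k ∈ windowIdx n δ h x, |a k|) ^ 2 ≤ (3 * B / h) ^ 2 := by
    calc (∑ k ∈ windowIdx n δ h x, |a k|) ^ 2
        ≤ (windowIdx n δ h x).card * ∑ k ∈ windowIdx n δ h x, |a k| ^ 2 :=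
          sq_sum_le_card_mul_sum_sq
      _ ≤ 3 * h / δ * (3 * h / δ * (B * δ / h ^ 2) ^ 2) := by
          simp only [sq_abs]; gcongr
      _ = _ := by field_simp
  exact (sq_le_sq₀ (Finset.sum_nonneg fun _ _ => abs_nonneg _) (by positivity)).1 hcs

end Window

/-! ### Polynomial approximation and extrapolation -/

section Taylor

open Polynomial

lemma exists_antiderivative (p : ℝ[X]) (x c : ℝ) :
    ∃ q : ℝ[X], derivative q = p ∧ q.eval x = c ∧ q.natDegree ≤ p.natDegree + 1 := by
  set Q : ℝ[X] := ∑ i ∈ Finset.range (p.natDegree + 1), C (p.coeff i / (i + 1)) * X ^ (i + 1)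
    with hQ
  refine ⟨Q + C (c - Q.eval x), ?_, by simp, ?_⟩
  · rw [derivative_add, derivative_C, add_zero, hQ, derivative_sum]
    conv_rhs => rw [p.as_sum_range_C_mul_X_pow]
    refine Finset.sum_congr rfl fun i _ => ?_
    rw [derivative_C_mul_X_pow, Nat.add_sub_cancel]
    congr 2
    push_cast
    field_simp
  · refine natDegree_add_C.le.trans (natDegree_sum_le_of_forall_le _ _ fun i hi => ?_)
    refine (natDegree_C_mul_X_pow_le _ _).trans ?_
    have := Finset.mem_range.1 hi
    omega

/-- Taylor approximation of functions with a Hölder continuous derivative. -/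
lemma exists_taylor_approx {a b x₀ L γ : ℝ} (hab : a < b) (hx₀ : x₀ ∈ Icc a b) (hL : 0 ≤ L)
    (hγ : 0 < γ) (m : ℕ) (f : ℝ → ℝ) (hf : ContDiffOn ℝ m f (Icc a b))
    (hH : ∀ x ∈ Icc a b, |iteratedDerivWithin m f (Icc a b) x
      - iteratedDerivWithin m f (Icc a b) x₀| ≤ L * |x - x₀| ^ γ) :
    ∃ p : ℝ[X], p.natDegree ≤ m ∧
      ∀ x ∈ Icc a b, |f x - p.eval x| ≤ L * |x - x₀| ^ (γ + m) := by
  induction m generalizing f with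
  | zero =>
    refine ⟨C (f x₀), by simp, fun x hx => ?_⟩
    simpa using hH x hx
  | succ m ih =>
    have hu := uniqueDiffOn_Icc hab
    have hf1 : ContDiffOn ℝ ((m : WithTop ℕ∞) + 1) f (Icc a b) := by exact_mod_cast hf
    have hf' := (contDiffOn_succ_iff_derivWithin hu).1 hf1
    obtain ⟨p, hp, hpb⟩ := ih (derivWithin f (Icc a b)) hf'.2.2 fun x hx => by
      have := hH x hx
      rwa [iteratedDerivWithin_succ'] at this
    -- The polynomial for f is the antiderivative of the one for f' with value f x₀ at x₀; the mean
    -- value inequality gains one power of |x - x₀| and keeps the constant L.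
    obtain ⟨q, hq, hqx, hqd⟩ := exists_antiderivative p x₀ (f x₀)
    refine ⟨q, by omega, fun x hx => ?_⟩
    have hsub : uIcc x₀ x ⊆ Icc a b := uIcc_subset_Icc hx₀ hx
    have hder : ∀ y ∈ uIcc x₀ x, HasDerivWithinAt (fun z => f z - q.eval z)
        (derivWithin f (Icc a b) y - p.eval y) (uIcc x₀ x) y := by
      intro y hy
      refine ((hf'.1 y (hsub hy)).hasDerivWithinAt.mono hsub).sub ?_
      rw [← hq]
      exact (q.hasDerivAt y).hasDerivWithinAt
    have hbd : ∀ y ∈ uIcc x₀ x, ‖derivWithin f (Icc a b) y - p.eval y‖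
        ≤ L * |x - x₀| ^ (γ + m) := by
      intro y hy
      refine (hpb y (hsub hy)).trans (mul_le_mul_of_nonneg_left ?_ hL)
      exact Real.rpow_le_rpow (abs_nonneg _) (abs_sub_left_of_mem_uIcc hy) (by positivity)
    have := (convex_uIcc x₀ x).norm_image_sub_le_of_norm_hasDerivWithin_le hder hbd
      left_mem_uIcc right_mem_uIcc
    rw [hqx, sub_self, sub_zero, Real.norm_eq_abs, Real.norm_eq_abs] at this
    refine this.trans (le_of_eq ?_)
    push_cast
    rw [mul_assoc, ← add_assoc, Real.rpow_add_one' (abs_nonneg _) (by positivity)]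

/-- Extrapolation by finite differences. -/
lemma abs_sub_eval_le_of_shifts (ℓ : ℕ) (p : ℝ[X]) (hp : p.natDegree ≤ ℓ) (H : ℝ → ℝ)
    {y δ e : ℝ} (h1 : ∀ i ∈ Finset.Icc 1 (ℓ + 1), |H (y + i * δ) - p.eval (y + i * δ)| ≤ e)
    (h2 : ∀ i ≤ ℓ + 1, |H (y + i * δ) - H y| ≤ (ℓ + 1) * e) :
    |H y - p.eval y| ≤ 2 ^ (ℓ + 1) * (ℓ + 2) * e := by
  set s : ℕ → ℝ := fun i => (-1) ^ (ℓ + 1 - i) * ((ℓ + 1).choose i : ℝ) with hs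
  have habs : ∀ i, |s i| = ((ℓ + 1).choose i : ℝ) := fun i => by
    simp [hs, abs_mul]
  have hzero : ∀ r : ℝ[X], r.natDegree ≤ ℓ →
      ∑ i ∈ Finset.range (ℓ + 1 + 1), s i * r.eval (y + i * δ) = 0 := by
    intro r hr
    have hdeg : (r.comp (C y + X * C δ)).natDegree < ℓ + 1 := by
      refine Nat.lt_succ_of_le ((natDegree_comp_le).trans ?_)
      have : (C y + X * C δ).natDegree ≤ 1 := by compute_degree
      calc _ ≤ r.natDegree * 1 := Nat.mul_le_mul_left _ this
        _ ≤ ℓ := by omega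
    have h := congrFun (fwdDiff_iter_eq_zero_of_degree_lt hdeg) 0
    rw [fwdDiff_iter_eq_sum_shift] at h
    simp only [Pi.zero_apply] at h
    rw [← h]
    refine Finset.sum_congr rfl fun i _ => ?_
    simp [hs, mul_comm δ]
  have hp0 := hzero p hp
  have hc0 := hzero (C (H y)) (by simp)
  simp only [eval_C] at hc0
  -- The difference of order ℓ + 1 annihilates both p and the constant H y, so the error at y is
  -- expressed by the errors at its shifts and the increments of H.
  have hkey : s 0 * (H y - p.eval y)
      = ∑ i ∈ Finset.range (ℓ + 1 + 1), s i * (H (y + i * δ) - H y)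
        - ∑ i ∈ Finset.Icc 1 (ℓ + 1), s i * (H (y + i * δ) - p.eval (y + i * δ)) := by
    have hr : ∑ i ∈ Finset.range (ℓ + 1 + 1), s i * (H (y + i * δ) - p.eval (y + i * δ))
        = s 0 * (H y - p.eval y)
          + ∑ i ∈ Finset.Icc 1 (ℓ + 1), s i * (H (y + i * δ) - p.eval (y + i * δ)) := by
      rw [Finset.range_eq_Ico, Finset.sum_eq_sum_Ico_succ_bot (by omega)]
      simp only [Nat.cast_zero, zero_mul, add_zero, zero_add]
      rfl
    simp only [mul_sub, Finset.sum_sub_distrib] at hr ⊢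
    rw [hp0] at hr
    rw [hc0]
    linarith
  have hs0 : |s 0| = 1 := by rw [habs]; simp
  have hchoose : ∑ i ∈ Finset.range (ℓ + 1 + 1), ((ℓ + 1).choose i : ℝ) = 2 ^ (ℓ + 1) := by
    exact_mod_cast Nat.sum_range_choose (ℓ + 1)
  have he : 0 ≤ e := (abs_nonneg _).trans (h1 1 (by simp))
  calc |H y - p.eval y| = |s 0 * (H y - p.eval y)| := by rw [abs_mul, hs0, one_mul]
    _ ≤ ∑ i ∈ Finset.range (ℓ + 1 + 1), ((ℓ + 1).choose i : ℝ) * ((ℓ + 1) * e)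
        + ∑ i ∈ Finset.range (ℓ + 1 + 1), ((ℓ + 1).choose i : ℝ) * e := by
      rw [hkey]
      refine (abs_sub _ _).trans (add_le_add ?_ ?_)
      · refine (Finset.abs_sum_le_sum_abs _ _).trans (Finset.sum_le_sum fun i hi => ?_)
        rw [abs_mul, habs]
        have := Finset.mem_range.1 hi
        exact mul_le_mul_of_nonneg_left (h2 i (by omega)) (Nat.cast_nonneg _)
      · refine (Finset.abs_sum_le_sum_abs _ _).trans ?_
        refine le_trans (Finset.sum_le_sum (g := fun i => ((ℓ + 1).choose i : ℝ) * e)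
          fun i hi => ?_) (Finset.sum_le_sum_of_subset_of_nonneg ?_ fun i _ _ => by positivity)
        · rw [abs_mul, habs]
          exact mul_le_mul_of_nonneg_left (h1 i hi) (Nat.cast_nonneg _)
        · intro i hi
          have := Finset.mem_Icc.1 hi
          exact Finset.mem_range.2 (by omega)
    _ = 2 ^ (ℓ + 1) * (ℓ + 2) * e := by
      rw [← Finset.sum_mul, ← Finset.sum_mul, hchoose]; ring

end Taylor

/-! ### The covariance function as an antiderivative of the survival function -/

section CovFun

variable {ν : Measure ℝ} [IsProbabilityMeasure ν] {lam : ℝ}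

lemma measureReal_Ioi_eq (v : ℝ) : ν.real (Ioi v) = 1 - cdf ν v := by
  rw [cdf_eq_real, ← compl_Iic, measureReal_compl measurableSet_Iic, probReal_univ]

lemma max_sub_sub_max_sub {x y : ℝ} (hxy : x ≤ y) (u : ℝ) :
    max (u - x) 0 - max (u - y) 0 = ∫ v in x..y, (Iio u).indicator 1 v := by
  rw [intervalIntegral.integral_of_le hxy, integral_indicator_one measurableSet_Iio,
    measureReal_restrict_apply measurableSet_Iio]
  rcases le_total u x with h | h
  · have : Iio u ∩ Ioc x y = ∅ := by
      ext v
      simp only [mem_inter_iff, mem_Iio, mem_Ioc, mem_empty_iff_false, iff_false]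
      rintro ⟨h1, h2, -⟩
      linarith
    rw [this, max_eq_right (by linarith), max_eq_right (by linarith)]
    simp
  rcases le_or_gt u y with h' | h'
  · have : Iio u ∩ Ioc x y = Ioo x u := by
      ext v
      simp only [mem_inter_iff, mem_Iio, mem_Ioc, mem_Ioo]
      constructor
      · rintro ⟨h1, h2, -⟩; exact ⟨h2, h1⟩
      · rintro ⟨h1, h2⟩; exact ⟨h2, h1, by linarith⟩
    rw [this, max_eq_left (by linarith), max_eq_right (by linarith), Real.volume_real_Ioo_of_le h]
    ring
  · have : Iio u ∩ Ioc x y = Ioc x y := by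
      ext v
      simp only [mem_inter_iff, mem_Iio, mem_Ioc]
      constructor
      · rintro ⟨-, h2⟩; exact h2
      · rintro ⟨h1, h2⟩; exact ⟨by linarith, h1, h2⟩
    rw [this, max_eq_left (by linarith), max_eq_left (by linarith), Real.volume_real_Ioc_of_le hxy]
    ring

/-- The covariance function is an antiderivative of `-lam * (1 - G)`. -/
lemma covFun_sub_eq (hν : Integrable (fun u => u) ν) (x y : ℝ) :
    covFun lam ν y - covFun lam ν x = -lam * ∫ v in x..y, (1 - cdf ν v) := by
  wlog hxy : x ≤ y generalizing x y
  · have := this y x (le_of_not_ge hxy)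
    rw [intervalIntegral.integral_symm]
    linarith
  -- Fubini: the mass of u above v is 1 - G(v).
  have hswap : ∫ u, (∫ v in x..y, (Iio u).indicator (1 : ℝ → ℝ) v) ∂ν
      = ∫ v in x..y, (∫ u, (Iio u).indicator (1 : ℝ → ℝ) v ∂ν) := by
    rw [intervalIntegral.integral_of_le hxy]
    simp only [intervalIntegral.integral_of_le hxy]
    refine integral_integral_swap (μ := ν) (ν := volume.restrict (Ioc x y))
      (f := fun u v => (Iio u).indicator (1 : ℝ → ℝ) v) ?_
    have hset : MeasurableSet {p : ℝ × ℝ | p.2 < p.1} :=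
      measurableSet_lt measurable_snd measurable_fst
    have heq : (Function.uncurry fun u v => (Iio u).indicator (1 : ℝ → ℝ) v)
        = {p : ℝ × ℝ | p.2 < p.1}.indicator 1 := by
      ext ⟨u, v⟩
      simp [indicator_apply]
    rw [heq]
    exact (integrable_const (1 : ℝ)).indicator hset
  have hinner : ∀ v, ∫ u, (Iio u).indicator (1 : ℝ → ℝ) v ∂ν = 1 - cdf ν v := by
    intro v
    have : (fun u => (Iio u).indicator (1 : ℝ → ℝ) v) = (Ioi v).indicator 1 := by
      ext u
      simp [indicator_apply]
    rw [this, integral_indicator_one measurableSet_Ioi, measureReal_Ioi_eq]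
  simp only [hinner] at hswap
  rw [← hswap, covFun, covFun, ← mul_sub, ← integral_sub (integrable_max_sub hν y)
    (integrable_max_sub hν x), neg_mul, ← mul_neg, ← integral_neg]
  congr 1
  refine integral_congr_ae (Filter.Eventually.of_forall fun u => ?_)
  simp only [← max_sub_sub_max_sub hxy u]
  ring

lemma abs_covFun_sub_le (hlam : 0 ≤ lam) (hν : Integrable (fun u => u) ν) (x y : ℝ) :
    |covFun lam ν y - covFun lam ν x| ≤ lam * |y - x| := by
  rw [covFun_sub_eq hν, abs_mul, abs_neg, abs_of_nonneg hlam]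
  refine mul_le_mul_of_nonneg_left ?_ hlam
  have := intervalIntegral.norm_integral_le_of_norm_le_const (a := x) (b := y)
    (f := fun v => 1 - cdf ν v) (C := 1) fun v _ => by
      rw [Real.norm_eq_abs, abs_le]
      constructor <;> linarith [cdf_nonneg ν v, cdf_le_one ν v]
  simpa using this

open Polynomial in
/-- Local polynomial approximation of the covariance function. -/
lemma exists_covFun_approx (hlam : 0 ≤ lam) (hν : Integrable (fun u => u) ν) {β L a b x₀ : ℝ}
    (hβ : 0 < β) (hL : 0 ≤ L) (hab : a < b) (hx₀ : x₀ ∈ Icc a b)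
    (hmem : ν ∈ holderClass β L (Icc a b)) :
    ∃ p : ℝ[X], p.natDegree ≤ strictFloor β + 1 ∧
      (derivative p).eval x₀ = -lam * (1 - cdf ν x₀) ∧
      ∀ y ∈ Icc a b, |covFun lam ν y - p.eval y| ≤ lam * L * |y - x₀| ^ (β + 1) := by
  obtain ⟨-, hcd, hH⟩ := hmem
  have hγ : 0 < β - strictFloor β := by
    have h1 : 1 ≤ ⌈β⌉₊ := Nat.one_le_iff_ne_zero.2 (Nat.ceil_pos.2 hβ).ne'
    have h2 := Nat.ceil_lt_add_one hβ.le
    rw [strictFloor, Nat.cast_sub h1]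
    push_cast
    linarith
  obtain ⟨g, hg, hgb⟩ := exists_taylor_approx hab hx₀ hL hγ (strictFloor β) (cdf ν) hcd
    fun x hx => hH x hx x₀ hx₀
  rw [sub_add_cancel] at hgb
  have hg0 : g.eval x₀ = cdf ν x₀ := by
    have := hgb x₀ hx₀
    rw [sub_self, abs_zero, Real.zero_rpow hβ.ne', mul_zero] at this
    linarith [abs_nonpos_iff.1 this]
  -- Integrating the Taylor polynomial g of G gives a p with the exact derivative at x₀, since g(x₀)
  -- = G(x₀).
  obtain ⟨p, hp, hpx, hpd⟩ := exists_antiderivative (C (-lam) * (1 - g)) x₀ (covFun lam ν x₀)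
  refine ⟨p, ?_, ?_, fun y hy => ?_⟩
  · have h1 : (1 - g).natDegree ≤ strictFloor β :=
      (natDegree_sub_le _ _).trans (by simpa using hg)
    have h2 : (C (-lam) * (1 - g)).natDegree ≤ (1 - g).natDegree := natDegree_C_mul_le _ _
    omega
  · rw [hp]; simp [hg0]
  · have hpint : p.eval y - p.eval x₀ = -lam * ∫ v in x₀..y, (1 - g.eval v) := by
      rw [← intervalIntegral.integral_const_mul]
      refine (intervalIntegral.integral_eq_sub_of_hasDerivAt (f := fun v => p.eval v)
        (f' := fun v => -lam * (1 - g.eval v)) (fun v _ => ?_) ?_).symm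
      · have := p.hasDerivAt v
        rw [hp] at this
        simpa using this
      · exact Continuous.intervalIntegrable (by fun_prop) _ _
    have hi1 : IntervalIntegrable (fun v => 1 - cdf ν v) volume x₀ y :=
      intervalIntegrable_const.sub (monotone_cdf ν).intervalIntegrable
    have hi2 : IntervalIntegrable (fun v => 1 - g.eval v) volume x₀ y :=
      Continuous.intervalIntegrable (by fun_prop) _ _
    have heq : covFun lam ν y - p.eval y
        = -lam * ∫ v in x₀..y, ((1 - cdf ν v) - (1 - g.eval v)) := by
      rw [intervalIntegral.integral_sub hi1 hi2, mul_sub, ← hpint, ← covFun_sub_eq hν, hpx]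
      ring
    rw [heq, abs_mul, abs_neg, abs_of_nonneg hlam, mul_assoc]
    refine mul_le_mul_of_nonneg_left ?_ hlam
    have hsub : uIcc x₀ y ⊆ Icc a b := uIcc_subset_Icc hx₀ hy
    have := intervalIntegral.norm_integral_le_of_norm_le_const (a := x₀) (b := y)
      (f := fun v => (1 - cdf ν v) - (1 - g.eval v)) (C := L * |y - x₀| ^ β) fun v hv => by
        have hv' := uIoc_subset_uIcc hv
        rw [show (1 - cdf ν v) - (1 - g.eval v) = -(cdf ν v - g.eval v) by ring, norm_neg]
        refine (hgb v (hsub hv')).trans (mul_le_mul_of_nonneg_left ?_ hL)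
        exact Real.rpow_le_rpow (abs_nonneg _) (abs_sub_left_of_mem_uIcc hv') hβ.le
    refine this.trans (le_of_eq ?_)
    rw [mul_assoc, Real.rpow_add_one' (abs_nonneg _) (by positivity)]

end CovFun

/-! ### Bias and root-mean-square error -/

/-- The deterministic error of the estimator. -/
lemma abs_bias_le {ν : Measure ℝ} [IsProbabilityMeasure ν] {lam : ℝ} (hlam : 0 < lam)
    (hν : Integrable (fun u => u) ν) {β L x₀ d h δ : ℝ} {n ℓ : ℕ} (hβ : 0 < β) (hL : 0 ≤ L)
    (hδ : 0 < δ) (hh : 0 < h) (hhd : h ≤ d) (hx : h ≤ x₀) (hxn : x₀ + h < n * δ)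
    (hδh : (ℓ + 2) * δ ≤ 2 * h) (hℓ : strictFloor β + 1 ≤ ℓ)
    (hmem : ν ∈ holderClass β L (Icc (x₀ - d) (x₀ + d)))
    (hend : n * δ - δ < x₀ + h → δ ≤ L * h ^ (β + 1)) {a : ℕ → ℝ}
    (ha : Feasible n ℓ δ h x₀ a) :
    |1 + 1 / lam * ∑ k ∈ windowIdx n δ h x₀, a k * covFun lam ν (k * δ) - cdf ν x₀|
      ≤ (∑ k ∈ windowIdx n δ h x₀, |a k|) * (2 ^ (ℓ + 1) * (ℓ + 2) * (L * h ^ (β + 1))) := by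
  obtain ⟨p, hp, hpx, hpb⟩ := exists_covFun_approx hlam.le hν hβ hL
    (by linarith : x₀ - d < x₀ + d) ⟨by linarith, by linarith⟩ hmem
  set e := lam * (L * h ^ (β + 1)) with he
  have he0 : 0 ≤ e := by positivity
  have hin : ∀ y, x₀ - h ≤ y → y ≤ x₀ + h → |covFun lam ν y - p.eval y| ≤ e := by
    intro y h1 h2
    refine (hpb y ⟨by linarith, by linarith⟩).trans ?_
    rw [he, mul_assoc]
    gcongr
    exact abs_le.2 ⟨by linarith, by linarith⟩
  have hall : ∀ k ∈ windowIdx n δ h x₀,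
      |covFun lam ν (k * δ) - p.eval (k * δ)| ≤ 2 ^ (ℓ + 1) * (ℓ + 2) * e := by
    intro k hk
    obtain ⟨-, h1, h2, h3⟩ := mem_windowIdx_cases hδ hx hxn hk
    rcases le_or_gt (x₀ - h) (k * δ) with h4 | h4
    · refine (hin _ h4 h1).trans (le_mul_of_one_le_left he0 ?_)
      have := one_le_pow₀ (one_le_two (α := ℝ)) (n := ℓ + 1)
      have : (0 : ℝ) ≤ ℓ := Nat.cast_nonneg ℓ
      nlinarith
    -- A node below x₀ - h may lie outside the Hölder interval. Its shifts by δ, …, (ℓ + 1)δ lie in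
    -- [x₀ - h, x₀ + h] because (ℓ + 2)δ ≤ 2h, and R is λ-Lipschitz with λδ ≤ e, so the error
    -- extrapolates.
    · have hδe : lam * δ ≤ e :=
        mul_le_mul_of_nonneg_left (hend (h3.resolve_left (not_le.2 h4))) hlam.le
      refine abs_sub_eval_le_of_shifts ℓ p (hp.trans hℓ) (covFun lam ν) (δ := δ) ?_ ?_
      · intro i hi
        obtain ⟨hi1, hi2⟩ := Finset.mem_Icc.1 hi
        have hi1' : (1 : ℝ) ≤ i := by exact_mod_cast hi1
        have hi2' : (i : ℝ) ≤ ℓ + 1 := by exact_mod_cast hi2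
        have e1 : δ ≤ i * δ := by nlinarith
        have e2 : i * δ ≤ (ℓ + 1) * δ := by gcongr
        exact hin _ (by linarith) (by linarith)
      · intro i hi
        have hi' : (i : ℝ) ≤ ℓ + 1 := by exact_mod_cast hi
        refine (abs_covFun_sub_le hlam.le hν _ _).trans ?_
        rw [add_sub_cancel_left, abs_of_nonneg (by positivity)]
        calc lam * (i * δ) = i * (lam * δ) := by ring
          _ ≤ (ℓ + 1) * e := by gcongr
  have hrep := (feasible_iff n ℓ δ h x₀ a).1 ha p (hp.trans hℓ)
  have heq : 1 + 1 / lam * ∑ k ∈ windowIdx n δ h x₀, a k * covFun lam ν (k * δ) - cdf ν x₀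
      = 1 / lam * ∑ k ∈ windowIdx n δ h x₀, a k * (covFun lam ν (k * δ) - p.eval (k * δ)) := by
    have h1 : 1 / lam * (-lam * (1 - cdf ν x₀)) = -(1 - cdf ν x₀) := by field_simp
    simp only [mul_sub (a _), Finset.sum_sub_distrib]
    rw [hrep, hpx, mul_sub (1 / lam), h1]
    ring
  rw [heq, abs_mul, abs_of_pos (by positivity)]
  calc 1 / lam * |∑ k ∈ windowIdx n δ h x₀, a k * (covFun lam ν (k * δ) - p.eval (k * δ))|
      ≤ 1 / lam * ∑ k ∈ windowIdx n δ h x₀, |a k| * (2 ^ (ℓ + 1) * (ℓ + 2) * e) := by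
        gcongr
        refine (Finset.abs_sum_le_sum_abs _ _).trans (Finset.sum_le_sum fun k hk => ?_)
        rw [abs_mul]
        exact mul_le_mul_of_nonneg_left (hall k hk) (abs_nonneg _)
    _ = _ := by
        rw [← Finset.sum_mul, he]
        field_simp

/-- The root-mean-square error of the estimator for one realization of the queue. -/
lemma IsMGInfinity.rms_error_le {Ω : Type*} [MeasurableSpace Ω] {P : Measure Ω}
    [IsProbabilityMeasure P] {lam δ K κ T h x₀ M S b : ℝ} {ν : Measure ℝ} {τ σ : ℤ → Ω → ℝ}
    {n : ℕ} {a : ℕ → ℝ}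
    (hq : IsMGInfinity P lam ν τ σ) (hlam : 0 < lam) (hν : HasSecondMoment ν K) (hδ : 0 < δ)
    (hδK : δ ≤ √K) (hκT : 0 < κ * T)
    (hwin : ∀ k ∈ windowIdx n δ h x₀, k < n ∧ κ * T ≤ ((n : ℝ) - k) * δ)
    (hM : K * max (√K) 1 * (1 + 1 / lam) / (κ * T) = M ^ 2)
    (hM0 : 0 ≤ M) (hb0 : 0 ≤ b) (hS : ∑ k ∈ windowIdx n δ h x₀, |a k| ≤ S)
    (hbias : |1 + 1 / lam * ∑ k ∈ windowIdx n δ h x₀, a k * covFun lam ν (k * δ) - cdf ν x₀|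
      ≤ S * (b * M)) :
    (∫⁻ ω, ‖GHat lam n δ h x₀ a (sample τ σ δ ω) - cdf ν x₀‖ₑ ^ 2 ∂P) ^ (1 / 2 : ℝ)
      ≤ ENNReal.ofReal ((7 + 2 * b) * (S * M)) := by
  set W := windowIdx n δ h x₀ with hW
  set D : ℕ → Ω → ℝ := fun k ω => RHat n (sample τ σ δ ω) k - covFun lam ν (k * δ) with hD
  set B := 1 + 1 / lam * ∑ k ∈ W, a k * covFun lam ν (k * δ) - cdf ν x₀ with hB
  have hS0 : 0 ≤ S := (Finset.sum_nonneg fun k _ => abs_nonneg (a k)).trans hS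
  have hdec : ∀ ω, GHat lam n δ h x₀ a (sample τ σ δ ω) - cdf ν x₀
      = 1 / lam * ∑ k ∈ W, a k * D k ω + B := by
    intro ω
    simp only [GHat, hD, hB, mul_sub (a _), Finset.sum_sub_distrib]
    ring
  have hDk : ∀ k ∈ W, Integrable (fun ω => D k ω ^ 2) P ∧
      ∫ ω, D k ω ^ 2 ∂P ≤ 20 * lam ^ 2 * M ^ 2 := by
    intro k hk
    obtain ⟨hkn, hkT⟩ := hwin k hk
    obtain ⟨h1, h2⟩ := hq.integral_RHat_sub_sq_le hlam hν hδ hδK hkn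
    refine ⟨h1, h2.trans ?_⟩
    rw [← hM, ← mul_div_assoc]
    have hK : 0 ≤ K := (integral_nonneg fun u => sq_nonneg u).trans hν.sq_le
    gcongr
  set g : Ω → ℝ := fun ω => 2 * (1 / lam) ^ 2 * (S * ∑ k ∈ W, |a k| * D k ω ^ 2) + 2 * B ^ 2
    with hg
  have hle : ∀ ω, (GHat lam n δ h x₀ a (sample τ σ δ ω) - cdf ν x₀) ^ 2 ≤ g ω := by
    intro ω
    -- Cauchy–Schwarz with weights |a_k|, so only the mean squared error at each lag is needed.
    have hcs : (∑ k ∈ W, a k * D k ω) ^ 2 ≤ (∑ k ∈ W, |a k|) * ∑ k ∈ W, |a k| * D k ω ^ 2 :=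
      Finset.sum_sq_le_sum_mul_sum_of_sq_le_mul W (fun k _ => abs_nonneg _)
        (fun k _ => by positivity) fun k _ => le_of_eq (by
          rw [← mul_assoc, abs_mul_abs_self]; ring)
    have hcs2 : (∑ k ∈ W, a k * D k ω) ^ 2 ≤ S * ∑ k ∈ W, |a k| * D k ω ^ 2 :=
      hcs.trans (mul_le_mul_of_nonneg_right hS (Finset.sum_nonneg fun k _ => by positivity))
    rw [hdec ω]
    calc (1 / lam * ∑ k ∈ W, a k * D k ω + B) ^ 2
        ≤ 2 * (1 / lam) ^ 2 * (∑ k ∈ W, a k * D k ω) ^ 2 + 2 * B ^ 2 := by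
          nlinarith [sq_nonneg (1 / lam * ∑ k ∈ W, a k * D k ω - B)]
      _ ≤ g ω := by
          simp only [hg]
          gcongr
  have hsumint : Integrable (fun ω => ∑ k ∈ W, |a k| * D k ω ^ 2) P :=
    integrable_finsetSum _ fun k hk => (hDk k hk).1.const_mul _
  have hgi : Integrable g P := ((hsumint.const_mul S).const_mul _).add (integrable_const _)
  have hgI : ∫ ω, g ω ∂P ≤ ((7 + 2 * b) * (S * M)) ^ 2 := by
    have h1 : ∫ ω, g ω ∂P = 2 * (1 / lam) ^ 2 * (S * ∑ k ∈ W, |a k| * ∫ ω, D k ω ^ 2 ∂P)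
        + 2 * B ^ 2 := by
      rw [integral_add ((hsumint.const_mul S).const_mul _) (integrable_const _),
        integral_const_mul, integral_const_mul,
        integral_finsetSum _ fun k hk => (hDk k hk).1.const_mul _, integral_const, probReal_univ,
        one_smul]
      simp only [integral_const_mul]
    have h2 : ∑ k ∈ W, |a k| * ∫ ω, D k ω ^ 2 ∂P ≤ S * (20 * lam ^ 2 * M ^ 2) := by
      calc _ ≤ ∑ k ∈ W, |a k| * (20 * lam ^ 2 * M ^ 2) := Finset.sum_le_sum fun k hk =>
            mul_le_mul_of_nonneg_left (hDk k hk).2 (abs_nonneg _)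
        _ ≤ _ := by rw [← Finset.sum_mul]; gcongr
    have h3 : B ^ 2 ≤ (S * (b * M)) ^ 2 := sq_le_sq' (by linarith [neg_abs_le B])
      ((le_abs_self B).trans hbias)
    calc ∫ ω, g ω ∂P ≤ 2 * (1 / lam) ^ 2 * (S * (S * (20 * lam ^ 2 * M ^ 2)))
          + 2 * (S * (b * M)) ^ 2 := by rw [h1]; gcongr
      _ = (40 + 2 * b ^ 2) * (S * M) ^ 2 := by field_simp; ring
      -- The number 7 is chosen with 40 ≤ 7².
      _ ≤ (7 + 2 * b) ^ 2 * (S * M) ^ 2 := by gcongr; nlinarith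
      _ = _ := by ring
  have hmain : ∫⁻ ω, ‖GHat lam n δ h x₀ a (sample τ σ δ ω) - cdf ν x₀‖ₑ ^ 2 ∂P
      ≤ ENNReal.ofReal ((7 + 2 * b) * (S * M)) ^ 2 := by
    rw [← ENNReal.ofReal_pow (by positivity)]
    calc _ ≤ ∫⁻ ω, ENNReal.ofReal (g ω) ∂P := lintegral_mono fun ω => by
          rw [← ofReal_norm, ← ENNReal.ofReal_pow (norm_nonneg _), Real.norm_eq_abs,
            sq_abs]
          exact ENNReal.ofReal_le_ofReal (hle ω)
      _ = ENNReal.ofReal (∫ ω, g ω ∂P) :=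
          (ofReal_integral_eq_lintegral_ofReal hgi (Filter.Eventually.of_forall fun ω =>
            (sq_nonneg _).trans (hle ω))).symm
      _ ≤ _ := ENNReal.ofReal_le_ofReal hgI
  calc _ ≤ (ENNReal.ofReal ((7 + 2 * b) * (S * M)) ^ 2) ^ (1 / 2 : ℝ) :=
        ENNReal.rpow_le_rpow hmain (by norm_num)
    _ = _ := by
        rw [← ENNReal.rpow_natCast, ← ENNReal.rpow_mul]
        norm_num

/-! ### The bandwidth equation -/

section Bandwidth

variable {β L K κ lam T d δ : ℝ}

lemma hStar_pos (hL : 0 < L) (hK : 0 < K) (hκ : 0 < κ) (hlam : 0 < lam) (hT : 0 < T) :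
    0 < hStar β L K κ lam T := by
  unfold hStar
  have : 0 < max (√K) 1 := lt_max_of_lt_right one_pos
  positivity

lemma hStar_rpow (hβ : 0 < β) (hL : 0 < L) (hK : 0 < K) (hκ : 0 < κ) (hlam : 0 < lam)
    (hT : 0 < T) :
    hStar β L K κ lam T ^ (2 * β + 2) = K * max (√K) 1 / (L ^ 2 * κ * T) * (1 + 1 / lam) := by
  have : 0 < max (√K) 1 := lt_max_of_lt_right one_pos
  unfold hStar
  rw [← Real.rpow_mul (by positivity), one_div_mul_cancel (by positivity), Real.rpow_one]

lemma rpow_le_rpow_iff_le {x y r : ℝ} (hx : 0 ≤ x) (hy : 0 ≤ y) (hr : 0 < r)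
    (h : x ^ r ≤ y ^ r) : x ≤ y := (Real.rpow_le_rpow_iff hx hy hr).1 h

lemma hStar_le (hβ : 0 < β) (hL : 0 < L) (hK : 0 < K) (hκ : 0 < κ) (hlam : 0 < lam)
    (hT : 0 < T) (hd : 0 < d)
    (h : K * max (√K) 1 / (L ^ 2 * κ) * (1 + 1 / lam) * d ^ (-2 * β - 2) ≤ T) :
    hStar β L K κ lam T ≤ d := by
  refine rpow_le_rpow_iff_le (hStar_pos hL hK hκ hlam hT).le hd.le
    (by linarith : 0 < 2 * β + 2) ?_
  rw [hStar_rpow hβ hL hK hκ hlam hT]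
  rw [show -2 * β - 2 = -(2 * β + 2) by ring, Real.rpow_neg hd.le] at h
  have hdp : 0 < d ^ (2 * β + 2) := Real.rpow_pos_of_pos hd _
  rw [← div_eq_mul_inv, div_le_iff₀ hdp] at h
  calc _ = K * max (√K) 1 / (L ^ 2 * κ) * (1 + 1 / lam) / T := by field_simp
    _ ≤ _ := by rw [div_le_iff₀ hT]; linarith

lemma le_hStar (hβ : 0 < β) (hL : 0 < L) (hK : 0 < K) (hκ : 0 < κ) (hlam : 0 < lam)
    (hT : 0 < T) {c : ℝ} (hc : 0 < c)
    (h : T ≤ K * max (√K) 1 / (L ^ 2 * κ) * (1 + 1 / lam) * (2 / c) ^ (2 * β + 2)) :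
    c ≤ 2 * hStar β L K κ lam T := by
  have hpos := hStar_pos (β := β) hL hK hκ hlam hT
  rw [show (2 : ℝ) / c = (c / 2)⁻¹ by rw [inv_div], Real.inv_rpow (by positivity),
    ← div_eq_mul_inv, le_div_iff₀ (by positivity)] at h
  have : c / 2 ≤ hStar β L K κ lam T := by
    refine rpow_le_rpow_iff_le (by positivity) hpos.le (by linarith : 0 < 2 * β + 2) ?_
    rw [hStar_rpow hβ hL hK hκ hlam hT]
    calc (c / 2) ^ (2 * β + 2) ≤ K * max (√K) 1 / (L ^ 2 * κ) * (1 + 1 / lam) / T := by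
          rw [le_div_iff₀ hT]; linarith
      _ = _ := by field_simp
  linarith

/-- The balance defining h_*: the stochastic scale M equals the bias scale L h_*^(β+1). -/
lemma sq_mul_hStar_rpow (hβ : 0 < β) (hL : 0 < L) (hK : 0 < K) (hκ : 0 < κ) (hlam : 0 < lam)
    (hT : 0 < T) :
    K * max (√K) 1 * (1 + 1 / lam) / (κ * T) = (L * hStar β L K κ lam T ^ (β + 1)) ^ 2 := by
  rw [mul_pow, ← Real.rpow_mul_natCast (hStar_pos hL hK hκ hlam hT).le,
    show (β + 1) * ((2 : ℕ) : ℝ) = 2 * β + 2 by push_cast; ring,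
    hStar_rpow hβ hL hK hκ hlam hT]
  field_simp

/-- The expression raised to β/(2β+2) is (L h_*^(β+1))², which contributes L^(β/(β+1)) h_*^β; the
prefactor completes the power of L to 1. -/
lemma rate_eq (hβ : 0 < β) (hL : 0 < L) (hK : 0 < K) (hκ : 0 < κ) (hlam : 0 < lam)
    (hT : 0 < T) :
    L ^ (1 / (β + 1)) * (K * max (√K) 1 / (κ * T) * (1 + 1 / lam)) ^ (β / (2 * β + 2))
      = L * hStar β L K κ lam T ^ β := by
  have hpos := hStar_pos (β := β) hL hK hκ hlam hT
  have h1 : K * max (√K) 1 / (κ * T) * (1 + 1 / lam)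
      = L ^ (2 : ℝ) * hStar β L K κ lam T ^ (2 * β + 2) := by
    rw [hStar_rpow hβ hL hK hκ hlam hT, Real.rpow_two]
    field_simp
  rw [h1, Real.mul_rpow (by positivity) (by positivity), ← Real.rpow_mul hL.le,
    ← Real.rpow_mul hpos.le, ← mul_assoc, ← Real.rpow_add hL]
  have e1 : 1 / (β + 1) + 2 * (β / (2 * β + 2)) = 1 := by field_simp; ring
  have e2 : (2 * β + 2) * (β / (2 * β + 2)) = β := by field_simp
  rw [e1, e2, Real.rpow_one]

end Bandwidth

end MGInfinity

/-! ### The risk bound -/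

theorem theorem1 (ℓ : ℕ) :
    ∃ C : ℝ, 0 < C ∧
      ∀ (β L K κ lam d x₀ δ T : ℝ) (n : ℕ),
        0 < β → 0 < L → 0 < K → 0 < κ → κ < 1 → 0 < lam → 0 < d → 0 < δ →
        T = n * δ →
        Set.Icc (x₀ - d) (x₀ + d) ⊆ Set.Icc 0 ((1 - κ) * T) →
        MGInfinity.strictFloor β + 1 ≤ ℓ →
        -- the sampling step does not exceed the scale of the service times
        δ ≤ √K →
        -- the two-sided condition on `T`
        K * max (√K) 1 / (L ^ 2 * κ) * (1 + 1 / lam) * d ^ (-2 * β - 2) ≤ T →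
        T ≤ K * max (√K) 1 / (L ^ 2 * κ) * (1 + 1 / lam) *
          (2 / (((ℓ : ℝ) + 2) * δ)) ^ (2 * β + 2) →
        -- the weights exist, and the estimator obeys the bound
        (∃ a : ℕ → ℝ,
          MGInfinity.IsOptimalWeight n ℓ δ (MGInfinity.hStar β L K κ lam T) x₀ a) ∧
        ∀ a : ℕ → ℝ,
          MGInfinity.IsOptimalWeight n ℓ δ (MGInfinity.hStar β L K κ lam T) x₀ a →
          MGInfinity.maximalRisk.{u} lam δ
              (MGInfinity.GHat lam n δ (MGInfinity.hStar β L K κ lam T) x₀ a) x₀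
              (MGInfinity.serviceClass β L (Set.Icc (x₀ - d) (x₀ + d)) K)
            ≤ ENNReal.ofReal (C * L ^ (1 / (β + 1)) *
                (K * max (√K) 1 / (κ * T) * (1 + 1 / lam)) ^ (β / (2 * β + 2))) := by
  set C₁ : ℝ := 3 * (ℓ * 2 ^ (ℓ - 1) * (ℓ + 2) ^ (ℓ + 1)) with hC₁
  set b : ℝ := 2 ^ (ℓ + 1) * (ℓ + 2) with hb
  have hC₁0 : 0 ≤ C₁ := by positivity
  have hb0 : 0 ≤ b := by positivity
  -- Adding 1 keeps the constant positive when ℓ = 0, where C₁ = 0.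
  refine ⟨(7 + 2 * b) * C₁ + 1, by positivity, ?_⟩
  intro β L K κ lam d x₀ δ T n hβ hL hK hκ hκ1 hlam hd hδ hT hI hℓ hδK hT1 hT2
  have hmax : 0 < max (√K) 1 := lt_max_of_lt_right one_pos
  have hT0 : 0 < T := lt_of_lt_of_le (by positivity) hT1
  set h := MGInfinity.hStar β L K κ lam T with hh
  have hh0 : 0 < h := MGInfinity.hStar_pos hL hK hκ hlam hT0
  have hhd : h ≤ d := MGInfinity.hStar_le hβ hL hK hκ hlam hT0 hd hT1
  have hhδ : ((ℓ : ℝ) + 2) * δ ≤ 2 * h :=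
    MGInfinity.le_hStar hβ hL hK hκ hlam hT0 (by positivity) hT2
  have hlow : 0 ≤ x₀ - d := (hI ⟨le_rfl, by linarith⟩).1
  have hup : x₀ + d ≤ (1 - κ) * T := (hI ⟨by linarith, le_rfl⟩).2
  have hκT : 0 < κ * T := by positivity
  have hx : h ≤ x₀ := by linarith
  have hxn : x₀ + h < n * δ := by rw [← hT]; linarith
  obtain ⟨hex, hbd⟩ := MGInfinity.weights_bound (by omega : 1 ≤ ℓ) hδ hh0 hx hxn hhδ
  refine ⟨hex, fun a ha => ?_⟩
  have hM := MGInfinity.sq_mul_hStar_rpow (β := β) hβ hL hK hκ hlam hT0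
  have hM0 : 0 ≤ L * h ^ (β + 1) := by positivity
  -- The right-end window arises only if κT ≤ δ ≤ √K. Then δ²κT ≤ K√K, so δ ≤ M = L h^(β+1).
  have hend : n * δ - δ < x₀ + h → δ ≤ L * h ^ (β + 1) := by
    intro hlt
    rw [← hT] at hlt
    have hκδ : κ * T ≤ δ := by linarith
    refine (sq_le_sq₀ hδ.le hM0).1 ?_
    rw [← hM, le_div_iff₀ hκT]
    have hδ2 : δ ^ 2 ≤ K := by
      rw [← Real.sq_sqrt hK.le]; exact pow_le_pow_left₀ hδ.le hδK 2
    calc δ ^ 2 * (κ * T) ≤ K * max (√K) 1 :=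
          mul_le_mul hδ2 (hκδ.trans (hδK.trans (le_max_left _ _))) hκT.le hK.le
      _ ≤ K * max (√K) 1 * (1 + 1 / lam) :=
          le_mul_of_one_le_right (by positivity) (by
            have : 0 < 1 / lam := by positivity
            linarith)
  have hwin : ∀ k ∈ MGInfinity.windowIdx n δ h x₀, k < n ∧ κ * T ≤ ((n : ℝ) - k) * δ := by
    intro k hk
    obtain ⟨h1, h2, -, -⟩ := MGInfinity.mem_windowIdx_cases hδ hx hxn hk
    refine ⟨h1, ?_⟩
    rw [sub_mul, ← hT]
    linarith
  refine iSup_le fun ν => iSup_le fun hν => iSup_le fun Ω => iSup_le fun _ => iSup_le fun P =>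
    iSup_le fun _ => iSup_le fun τ => iSup_le fun σ => iSup_le fun hq => ?_
  have hν2 := MGInfinity.hasSecondMoment_of_mem hK.le hν.2
  have := hν2.prob
  have hbias := MGInfinity.abs_bias_le hlam hν2.integrable hβ hL.le hδ hh0 hhd hx hxn hhδ hℓ hν.1
    hend ha.1
  have hS := hbd a ha
  have hrisk := hq.rms_error_le hlam hν2 hδ hδK hκT hwin hM hM0 hb0 hS
    (hbias.trans (mul_le_mul_of_nonneg_right hS (by positivity)))
  refine hrisk.trans (ENNReal.ofReal_le_ofReal ?_)
  rw [mul_assoc _ (L ^ (1 / (β + 1))), MGInfinity.rate_eq hβ hL hK hκ hlam hT0]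
  have hpow : C₁ / h * (L * h ^ (β + 1)) = C₁ * (L * h ^ β) := by
    rw [Real.rpow_add_one hh0.ne']
    field_simp
  rw [hpow]
  have : 0 ≤ L * h ^ β := by positivity
  linarith
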